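/- Fix $c>0$ and $R_0>0$, put $\epsilon(h)=c/\log(R_0/h)$ for $0<h<R_0$, and write $s(h)=h\,\epsilon(h)$ and $\Lambda(h)=\log\big(s(h)^{-1}\big)/s(h)$. Let $C_1>100$. For each small $h>0$ let $(D_{j,h})_j$ be a collection of closed discs in the plane $\mathbb R^2$, all of radius $32\,s(h)$, such that any two distinct discs of the collection are at distance at least $32\,C_1\,s(h)$; for $t>0$ let $tD_{j,h}$ be the disc with the same centre and $t$ times the radius. Let $\tilde R_0>0$, and let $B(0,r)$ be the open disc of radius $r$ centred at $0$. Call a real function $f$ admissible at $h$ if $f$ is harmonic on $B(0,\tilde R_0)\setminus\bigcup_j D_{j,h}$ and, for each $j$, $f\ge 0$ on all of $(B(0,\tilde R_0)\cap 5D_{j,h})\setminus D_{j,h}$ or $f\le 0$ on all of it. All integrals below are with respect to Lebesgue measure and take values in $[0,\infty]$. **Interior case.** For every $0<\tilde R<\tilde R_0$ there exist constants $\tilde C'>C'>0$ and $h_0>0$ such that for all $0<h<h_0$ and all $f$ admissible at $h$, $$\int_{B(0,\tilde R)\setminus\bigcup_j 3D_{j,h}} f^2\;+\;e^{-\tilde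 C'\Lambda(h)}\int_{B(0,\tilde R_0)\setminus\left(B(0,\tilde R_0/2)\,\cup\,\bigcup_j 3D_{j,h}\right)} f^2\;\ge\; e^{-C'\Lambda(h)}\int_{B(0,\tilde R_0/2)\setminus\left(B(0,\tilde R)\,\cup\,\bigcup_j 3D_{j,h}\right)} f^2 .$$ **Boundary case.** For every $0<\tilde R_1<\tilde R_2<\tilde R_0$ there exist constants $C'>0$ and $h_0>0$ such that for all $0<h<h_0$ and all $f$ admissible at $h$, $$\int_{B(0,\tilde R_2)\setminus\left(B(0,\tilde R_1)\,\cup\,\bigcup_j 3D_{j,h}\right)} f^2\;\ge\; e^{-C'\Lambda(h)}\int_{B(0,\tilde R_1)\setminus\bigcup_j 3D_{j,h}} f^2 .$$ -/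

import Mathlib

open scoped ENNReal

noncomputable section

namespace ToyProblem

/-- The semiclassical scale `ε(h) = c / log (R₀ / h)`. -/
def eps (c R₀ h : ℝ) : ℝ := c / Real.log (R₀ / h)

/-- The length `h ε(h)`. -/
def scale (c R₀ h : ℝ) : ℝ := h * eps c R₀ h

/-- The exponent `log ((h ε(h))⁻¹) / (h ε(h))`. -/
def rate (c R₀ h : ℝ) : ℝ := Real.log ((scale c R₀ h)⁻¹) / scale c R₀ h

/-- The disc `t D`, where `D` is the disc of radius `32 h ε(h)` centred at `z`. -/
def disc (c R₀ h t : ℝ) (z : ℂ) : Set ℂ := Metric.closedBall z (t * (32 * scale c R₀ h))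

/-- The union of the dilated discs `t D` over all discs `D` with centre in `Z`. -/
def discs (c R₀ h t : ℝ) (Z : Set ℂ) : Set ℂ := ⋃ z ∈ Z, disc c R₀ h t z

/-- The discs of radius `32 h ε(h)` with centres in `Z` are at mutual distance at least
`32 C₁ h ε(h)`. -/
def Separated (c R₀ C₁ h : ℝ) (Z : Set ℂ) : Prop :=
  ∀ z ∈ Z, ∀ w ∈ Z, z ≠ w → ∀ x ∈ disc c R₀ h 1 z, ∀ y ∈ disc c R₀ h 1 w,
    32 * C₁ * scale c R₀ h ≤ dist x y

/-- `f` does not change sign on `A`. -/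
def NoSignChange (f : ℂ → ℝ) (A : Set ℂ) : Prop :=
  (∀ x ∈ A, 0 ≤ f x) ∨ (∀ x ∈ A, f x ≤ 0)

/-- `f` is harmonic on `B(0, ρ)` minus the discs `D`, and does not change sign on each
`(B(0, ρ) ∩ 5D) \ D`. -/
def Admissible (c R₀ h ρ : ℝ) (Z : Set ℂ) (f : ℂ → ℝ) : Prop :=
  InnerProductSpace.HarmonicOnNhd f (Metric.ball 0 ρ \ discs c R₀ h 1 Z) ∧
  ∀ z ∈ Z, NoSignChange f ((Metric.ball 0 ρ ∩ disc c R₀ h 5 z) \ disc c R₀ h 1 z)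

/-- The integral `∫_A f²` for Lebesgue measure on the plane, with values in `[0, ∞]`. -/
def sqInt (f : ℂ → ℝ) (A : Set ℂ) : ℝ≥0∞ := ∫⁻ x in A, ENNReal.ofReal (f x ^ 2)

end ToyProblem

end

noncomputable section

namespace ToyProblem

open InnerProductSpace Metric MeasureTheory Set Filter Topology
open scoped ENNReal ContDiff

/-! The engine is a Carleman inequality with weight `|g|²`, where `g` is holomorphic. Since `∂x +
i∂y` commutes with multiplication by `g` and `(∂x + i∂y)(∂x - i∂y) = Δ`, two applications of an `L²`
bound for the Cauchy–Riemann operator give `∫ |g|² u² ≲ ∫ |g|² (Δu)²` for compactly supported `u`,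
with a constant that does not depend on `g` (`carleman`).

It is applied to `u = η f`, where `η` cuts off near the boundary of the region and also vanishes
near every hole. As `f` is harmonic, `Δu` lives only where `η` varies. The boundary layers produce
the terms that the theorem allows. The rings around the holes must be absorbed, and this is where
the sign condition enters: by Harnack's inequality, `f` and its gradient on such a ring are
controlled by the mass of `f` on any small disc slightly further out. That disc is placed on the
side where `|g|` is larger, so the weight gains a factor `δ` which outweighs the polynomial loss
`r⁻⁶` once `r⁻⁶ δ` is small (`exists_weightedSqInt_le`).

For `g = exp (κ z)` the gain is `δ = exp (-(4/5) κ r)`, and for `g = z⁻ᵏ` it is the same with `k /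
S₀` in place of `κ`. With `r = 32 s`, beating `r⁻⁶` requires `κ` of order `log (1/s) / s`, which is
exactly `Λ`. The weight `z⁻ᵏ` decreases outwards, so it damps the outer layer relative to the middle
annulus and gives the interior case. The weight `exp (κ z)` is zero-free and holomorphic on the
whole disc and gives the boundary case. -/

/-! ### Mean values, Harnack inequalities and gradient bounds. -/

/-- The mean value property on discs. -/
theorem setIntegral_ball_eq_of_harmonic {f : ℂ → ℝ} {c : ℂ} {ρ : ℝ} (hρ : 0 < ρ)
    (hf : HarmonicOnNhd f (closedBall c ρ)) :
    ∫ z in ball c ρ, f z = Real.pi * ρ ^ 2 * f c := by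
  have hcirc : ∀ t ∈ Icc 0 ρ, ∫ θ in Ioo (-Real.pi) Real.pi, f (circleMap c t θ)
      = 2 * Real.pi * f c := by
    intro t ht
    have h1 : Real.circleAverage f c t = f c := by
      apply InnerProductSpace.HarmonicOnNhd.circleAverage_eq
      rw [abs_of_nonneg ht.1]
      exact hf.mono (closedBall_subset_closedBall ht.2)
    rw [Real.circleAverage_def] at h1
    have hper : Function.Periodic (fun θ => f (circleMap c t θ)) (2 * Real.pi) := fun θ => by
      simp only [periodic_circleMap c t θ]
    have h2 := hper.intervalIntegral_add_eq (-Real.pi) 0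
    rw [zero_add, show -Real.pi + 2 * Real.pi = Real.pi by ring,
      intervalIntegral.integral_of_le (by linarith [Real.pi_pos]),
      integral_Ioc_eq_integral_Ioo] at h2
    rw [h2, ← h1, smul_eq_mul]
    field_simp
  have hcont : ContinuousOn (fun p : ℝ × ℝ => p.1 * f (circleMap c p.1 p.2))
      (Icc 0 ρ ×ˢ Icc (-Real.pi) Real.pi) := by
    apply continuousOn_fst.mul
    apply hf.continuousOn.comp
    · unfold circleMap; fun_prop
    · rintro ⟨t, θ⟩ ⟨h1, -⟩
      rw [mem_closedBall, dist_eq_norm]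
      simp [circleMap, abs_of_nonneg h1.1, h1.2]
  have hint : IntegrableOn (fun p : ℝ × ℝ => p.1 * f (circleMap c p.1 p.2))
      (Ioo 0 ρ ×ˢ Ioo (-Real.pi) Real.pi) (volume.prod volume) :=
    (hcont.integrableOn_compact (isCompact_Icc.prod isCompact_Icc)).mono_set
      (prod_mono Ioo_subset_Icc_self Ioo_subset_Icc_self)
  have h1 : ∫ z in ball c ρ, f z
      = ∫ z, (ball (0 : ℂ) ρ).indicator (fun z => f (c + z)) z := by
    rw [← integral_indicator measurableSet_ball, ← integral_add_left_eq_self _ c]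
    congr 1
    ext z
    simp [indicator]
  rw [h1, ← Complex.integral_comp_polarCoord_symm]
  have h2 : ∀ p ∈ polarCoord.target,
      p.1 • (ball (0 : ℂ) ρ).indicator (fun z => f (c + z)) (Complex.polarCoord.symm p)
      = (Iio ρ ×ˢ univ).indicator (fun p : ℝ × ℝ => p.1 * f (circleMap c p.1 p.2)) p := by
    rintro ⟨t, θ⟩ hp
    have ht : 0 < t := by simpa [polarCoord] using hp.1
    have he : c + Complex.polarCoord.symm (t, θ) = circleMap c t θ := by
      rw [Complex.polarCoord_symm_apply]
      simp [circleMap, Complex.exp_mul_I]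
    have hn : Complex.polarCoord.symm (t, θ) ∈ ball (0 : ℂ) ρ ↔ t < ρ := by
      rw [mem_ball_zero_iff, Complex.norm_polarCoord_symm, abs_of_pos ht]
    by_cases h : t < ρ
    · rw [indicator_of_mem (hn.2 h), indicator_of_mem (by simpa using h), he]; rfl
    · rw [indicator_of_notMem (fun h' => h (hn.1 h')), indicator_of_notMem (by simpa using h),
        smul_zero]
  rw [setIntegral_congr_fun polarCoord.open_target.measurableSet h2,
    setIntegral_indicator (measurableSet_Iio.prod MeasurableSet.univ)]
  have h3 : polarCoord.target ∩ Iio ρ ×ˢ univ = Ioo 0 ρ ×ˢ Ioo (-Real.pi) Real.pi := by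
    rw [polarCoord_target, prod_inter_prod, inter_univ]; rfl
  rw [h3, Measure.volume_eq_prod, setIntegral_prod _ hint]
  simp only [integral_const_mul]
  rw [setIntegral_congr_fun (g := fun t => t * (2 * Real.pi * f c)) measurableSet_Ioo
    (fun t ht => by rw [hcirc t (Ioo_subset_Icc_self ht)]), integral_mul_const,
    ← integral_Ioc_eq_integral_Ioo, ← intervalIntegral.integral_of_le hρ.le, integral_id]
  ring

theorem volume_real_ball (c : ℂ) {ρ : ℝ} (hρ : 0 ≤ ρ) :
    volume.real (ball c ρ) = Real.pi * ρ ^ 2 := by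
  rw [Measure.real, Complex.volume_ball]
  simp [ENNReal.toReal_ofReal hρ]
  ring

theorem integrableOn_ball_of_continuousOn {f : ℂ → ℝ} {c : ℂ} {ρ : ℝ}
    (hf : ContinuousOn f (closedBall c ρ)) : IntegrableOn f (ball c ρ) :=
  (hf.integrableOn_compact (isCompact_closedBall c ρ)).mono_set ball_subset_closedBall

/-- Expand `∫ (f - f c)² ≥ 0` over the disc and use the mean value property in the cross term. -/
theorem sq_le_sqInt_ball {f : ℂ → ℝ} {c : ℂ} {ρ : ℝ} (hρ : 0 < ρ)
    (hf : HarmonicOnNhd f (closedBall c ρ)) :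
    ENNReal.ofReal (Real.pi * ρ ^ 2 * f c ^ 2) ≤ sqInt f (ball c ρ) := by
  have hi := integrableOn_ball_of_continuousOn hf.continuousOn
  have hi2 : IntegrableOn (fun z => f z ^ 2) (ball c ρ) :=
    integrableOn_ball_of_continuousOn (hf.continuousOn.pow 2)
  have hic : IntegrableOn (fun _ : ℂ => f c ^ 2) (ball c ρ) :=
    integrableOn_ball_of_continuousOn continuousOn_const
  unfold sqInt
  rw [← ofReal_integral_eq_lintegral_ofReal hi2 (Filter.Eventually.of_forall fun z => sq_nonneg _)]
  apply ENNReal.ofReal_le_ofReal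
  have h0 : 0 ≤ ∫ z in ball c ρ, (f z - f c) ^ 2 := integral_nonneg fun z => sq_nonneg _
  have h1 : ∫ z in ball c ρ, (f z - f c) ^ 2
      = (∫ z in ball c ρ, f z ^ 2) - 2 * f c * (∫ z in ball c ρ, f z)
        + Real.pi * ρ ^ 2 * f c ^ 2 := by
    rw [← integral_const_mul, ← integral_sub hi2 (hi.const_mul _)]
    have : Real.pi * ρ ^ 2 * f c ^ 2 = ∫ z in ball c ρ, f c ^ 2 := by
      rw [setIntegral_const, volume_real_ball c hρ.le, smul_eq_mul]
    have hi3 : IntegrableOn (fun z => f z ^ 2 - 2 * f c * f z) (ball c ρ) :=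
      hi2.sub (hi.const_mul _)
    rw [this, ← integral_add hi3 hic]
    congr 1; ext z; ring
  rw [setIntegral_ball_eq_of_harmonic hρ hf] at h1
  nlinarith

/-- Harnack's inequality with the sharp constant to first order. -/
theorem harnack_ball {f : ℂ → ℝ} {z w : ℂ} {ρ δ : ℝ} (hρ : 0 < ρ) (hδ : dist w z ≤ δ)
    (hf : HarmonicOnNhd f (closedBall z (ρ + δ))) (h0 : ∀ x ∈ closedBall z (ρ + δ), 0 ≤ f x) :
    ρ ^ 2 * f w ≤ (ρ + δ) ^ 2 * f z := by
  have hδ0 : 0 ≤ δ := dist_nonneg.trans hδ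
  -- Positivity allows the integral over the small disc to be compared with that over the larger one
  -- containing it; the mean value property evaluates both.
  have hsub : closedBall w ρ ⊆ closedBall z (ρ + δ) := closedBall_subset_closedBall' (by linarith)
  have hsub' : ball w ρ ⊆ ball z (ρ + δ) := ball_subset_ball' (by linarith)
  have h1 := setIntegral_ball_eq_of_harmonic hρ (hf.mono hsub)
  have h2 := setIntegral_ball_eq_of_harmonic (by linarith) hf
  have h3 : ∫ x in ball w ρ, f x ≤ ∫ x in ball z (ρ + δ), f x := by
    apply setIntegral_mono_set (integrableOn_ball_of_continuousOn hf.continuousOn)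
    · exact (ae_restrict_mem measurableSet_ball).mono fun x hx => h0 x (ball_subset_closedBall hx)
    · exact hsub'.eventuallyLE
  rw [h1, h2] at h3
  have := Real.pi_pos
  nlinarith [this]

/-- Harnack's inequality between `z` and `z + t v` is an equality at `t = 0`, so it can be
differentiated there from the right. Inner radius `ρ / 2` makes the slope `2 · (2 / ρ) = 4 / ρ`. -/
theorem abs_fderiv_le_of_nonneg {f : ℂ → ℝ} {z : ℂ} {ρ : ℝ} (hρ : 0 < ρ)
    (hf : HarmonicOnNhd f (ball z ρ)) (h0 : ∀ x ∈ ball z ρ, 0 ≤ f x) (v : ℂ) (hv : ‖v‖ = 1) :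
    |fderiv ℝ f z v| ≤ 4 / ρ * f z := by
  have hz : z ∈ ball z ρ := mem_ball_self hρ
  have hd : DifferentiableAt ℝ f z := (hf z hz).1.differentiableAt (by norm_num)
  -- one-sided bound in each unit direction
  have key : ∀ v : ℂ, ‖v‖ = 1 → fderiv ℝ f z v ≤ 4 / ρ * f z := by
    intro v hv
    have hline : HasDerivAt (fun t : ℝ => f (z + t • v)) (fderiv ℝ f z v) 0 := by
      simpa [HasLineDerivAt] using hd.hasFDerivAt.hasLineDerivAt v
    have hR : HasDerivAt (fun t : ℝ => ((ρ / 2 + t) / (ρ / 2)) ^ 2 * f z)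
        (4 / ρ * f z) 0 := by
      have h := ((((hasDerivAt_id (0 : ℝ)).const_add (ρ / 2)).div_const (ρ / 2)).pow 2).mul_const
        (f z)
      have he : 4 / ρ * f z = (2 : ℕ) * ((ρ / 2 + id 0) / (ρ / 2)) ^ (2 - 1) * (1 / (ρ / 2)) * f z := by
        have : ρ ≠ 0 := hρ.ne'
        simp only [id, add_zero, Nat.cast_ofNat, Nat.add_one_sub_one, pow_one]
        field_simp
        ring
      rw [he]
      exact h
    have hsub := hR.sub hline
    have hle : ∀ᶠ t in nhdsWithin (0 : ℝ) (Ioi 0), (0 : ℝ) ≤ slope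
        (fun t : ℝ => ((ρ / 2 + t) / (ρ / 2)) ^ 2 * f z - f (z + t • v)) 0 t := by
      filter_upwards [Ioo_mem_nhdsGT (show (0 : ℝ) < ρ / 2 by linarith)] with t ht
      have hs : closedBall z (ρ / 2 + t) ⊆ ball z ρ := closedBall_subset_ball (by linarith [ht.2])
      have := harnack_ball (f := f) (z := z) (w := z + t • v) (ρ := ρ / 2) (δ := t) (by linarith)
        (by simp [hv, abs_of_pos ht.1]) (hf.mono hs) (fun x hx => h0 x (hs hx))
      rw [slope_def_field]
      apply div_nonneg _ (by linarith [ht.1])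
      simp only [add_zero, zero_smul]
      rw [div_self (by linarith), one_pow, one_mul, sub_self, sub_zero, div_pow, div_mul_eq_mul_div,
        sub_nonneg, le_div_iff₀ (by positivity)]
      linarith
    have hlim := hasDerivAt_iff_tendsto_slope.1 hsub
    have hsubset : Ioi (0 : ℝ) ⊆ {0}ᶜ := fun x hx => ne_of_gt hx
    have h1 := ge_of_tendsto (hlim.mono_left (nhdsWithin_mono 0 hsubset)) hle
    linarith
  rw [abs_le]
  refine ⟨?_, key v hv⟩
  have := key (-v) (by simpa using hv)
  simp only [map_neg] at this
  linarith

/-- Apply the bound for nonnegative functions to `f + M`, which is at most `2M` at the centre. -/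
theorem abs_fderiv_le_of_abs_le {f : ℂ → ℝ} {z : ℂ} {ρ M : ℝ} (hρ : 0 < ρ)
    (hf : HarmonicOnNhd f (ball z ρ)) (hM : ∀ x ∈ ball z ρ, |f x| ≤ M) (v : ℂ) (hv : ‖v‖ = 1) :
    |fderiv ℝ f z v| ≤ 8 * M / ρ := by
  have hz : z ∈ ball z ρ := mem_ball_self hρ
  have h := abs_fderiv_le_of_nonneg (f := f + fun _ => M) hρ
    (hf.add (harmonicOnNhd_const M)) (fun x hx => by
      have := abs_le.1 (hM x hx); simp only [Pi.add_apply]; linarith) v hv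
  have he : fderiv ℝ (f + fun _ => M) z = fderiv ℝ f z := by
    exact fderiv_add_const (f := f) M
  rw [he] at h
  refine h.trans ?_
  have := (abs_le.1 (hM z hz)).2
  rw [Pi.add_apply, div_mul_eq_mul_div]
  exact div_le_div_of_nonneg_right (by linarith) hρ.le

/-- A Harnack chain. In the coordinate `log ((z - w) / r)` the annulus `2r ≤ |z - w| ≤ 4r` becomes a
vertical strip, which is convex, so a segment there joins the two points without leaving the
annulus. Each of 256 equal steps costs a factor 4. -/
theorem harnack_annulus : ∃ K : ℝ, 1 ≤ K ∧ ∀ (f : ℂ → ℝ) (w : ℂ) (r : ℝ), 0 < r →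
    HarmonicOnNhd f (ball w (5 * r) \ closedBall w r) →
    (∀ x ∈ ball w (5 * r) \ closedBall w r, 0 ≤ f x) →
    ∀ z q : ℂ, 2 * r ≤ dist z w → dist z w ≤ 4 * r → 2 * r ≤ dist q w → dist q w ≤ 4 * r →
      f z ≤ K * f q := by
  refine ⟨4 ^ 256, one_le_pow₀ (by norm_num), ?_⟩
  intro f w r hr hf h0 z q hz1 hz2 hq1 hq2
  have step : ∀ x y : ℂ, 2 * r ≤ dist y w → dist y w ≤ 4 * r → dist x y ≤ r / 4 →
      f x ≤ 4 * f y := by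
    intro x y hy1 hy2 hxy
    have hs : closedBall y (r / 4 + r / 4) ⊆ ball w (5 * r) \ closedBall w r := by
      intro p hp
      rw [mem_closedBall] at hp
      have h1 := dist_triangle p y w
      have h2 := dist_triangle y p w
      rw [dist_comm y p] at h2
      simp only [Set.mem_sdiff, mem_ball, mem_closedBall, not_le]
      constructor <;> linarith
    have := harnack_ball (by linarith) hxy (hf.mono hs) (fun p hp => h0 p (hs hp))
    have hr2 : 0 < r ^ 2 := by positivity
    nlinarith
  have hlog : ∀ p : ℂ, 2 * r ≤ dist p w → dist p w ≤ 4 * r → ∃ a : ℂ,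
      w + r * Complex.exp a = p ∧ Real.log 2 ≤ a.re ∧ a.re ≤ Real.log 4 ∧ |a.im| ≤ Real.pi := by
    intro p h1 h2
    have hn : ‖(p - w) / r‖ = dist p w / r := by
      rw [norm_div, dist_eq_norm]; simp [abs_of_pos hr]
    have hne : (p - w) / r ≠ 0 := by
      rw [← norm_pos_iff, hn]; apply div_pos _ hr; linarith
    have hr' : (r : ℂ) ≠ 0 := by exact_mod_cast hr.ne'
    refine ⟨Complex.log ((p - w) / r), ?_, ?_, ?_, ?_⟩
    · rw [Complex.exp_log hne]; field_simp; ring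
    · rw [Complex.log_re, hn]
      exact Real.log_le_log (by norm_num) ((le_div_iff₀ hr).2 h1)
    · rw [Complex.log_re, hn]
      exact Real.log_le_log (div_pos (by linarith) hr) ((div_le_iff₀ hr).2 h2)
    · rw [Complex.log_im]; exact Complex.abs_arg_le_pi _
  obtain ⟨a, ha, ha1, ha2, ha3⟩ := hlog q hq1 hq2
  obtain ⟨b, hb, hb1, hb2, hb3⟩ := hlog z hz1 hz2
  have h42 : Real.log 4 = 2 * Real.log 2 := by
    rw [show (4 : ℝ) = 2 ^ 2 by norm_num, Real.log_pow]; norm_num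
  have hl2 := Real.log_two_lt_d9
  have hab : ‖b - a‖ ≤ 8 := by
    refine (Complex.norm_le_abs_re_add_abs_im _).trans ?_
    have h1 : |(b - a).re| ≤ 1 := by
      rw [Complex.sub_re, abs_le]; constructor <;> linarith
    have h2 : |(b - a).im| ≤ 2 * Real.pi := by
      rw [Complex.sub_im]; rw [abs_le] at *; constructor <;> linarith
    linarith [Real.pi_lt_d2]
  -- A step of length at most `8 / 256 = 1 / 32` in the logarithm moves the point by at most `4r · 2
  -- · (1 / 32) = r / 4`, as `step` demands.
  set d : ℂ := (b - a) / 256 with hd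
  have hdn : ‖d‖ ≤ 1 / 32 := by
    rw [hd, norm_div]; norm_num; linarith
  have hre : ∀ n : ℕ, n ≤ 256 → 2 ≤ Real.exp (a + n * d).re ∧ Real.exp (a + n * d).re ≤ 4 := by
    intro n hn
    have hn' : (n : ℝ) / 256 ≤ 1 := by
      rw [div_le_one (by norm_num)]; exact_mod_cast hn
    have hn0 : (0 : ℝ) ≤ (n : ℝ) / 256 := by positivity
    have he : (a + n * d).re = (1 - (n : ℝ) / 256) * a.re + (n : ℝ) / 256 * b.re := by
      have : a + n * d = ((1 - (n : ℝ) / 256 : ℝ) : ℂ) * a + (((n : ℝ) / 256 : ℝ) : ℂ) * b := by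
        rw [hd]; push_cast; ring
      rw [this, Complex.add_re, Complex.re_ofReal_mul, Complex.re_ofReal_mul]
    rw [he, ← Real.log_le_iff_le_exp (by norm_num), ← Real.le_log_iff_exp_le (by norm_num)]
    constructor <;> nlinarith
  have hdist : ∀ n : ℕ, dist (w + r * Complex.exp (a + n * d)) w
      = r * Real.exp (a + n * d).re := by
    intro n
    rw [dist_eq_norm, add_sub_cancel_left, norm_mul, Complex.norm_exp, Complex.norm_real,
      Real.norm_of_nonneg hr.le]
  have hind : ∀ n : ℕ, n ≤ 256 → f (w + r * Complex.exp (a + n * d)) ≤ 4 ^ n * f q := by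
    intro n
    induction n with
    | zero => intro _; simp [ha]
    | succ n ih =>
      intro hn
      have hn' : n ≤ 256 := by omega
      obtain ⟨e1, e2⟩ := hre n hn'
      have := step (w + r * Complex.exp (a + (n + 1 : ℕ) * d)) (w + r * Complex.exp (a + n * d))
        (by rw [hdist]; nlinarith) (by rw [hdist]; nlinarith) (by
          rw [dist_eq_norm, show w + r * Complex.exp (a + (n + 1 : ℕ) * d)
            - (w + r * Complex.exp (a + n * d))
            = r * (Complex.exp (a + n * d) * (Complex.exp d - 1)) by
              rw [show a + ((n + 1 : ℕ) : ℂ) * d = (a + n * d) + d by push_cast; ring,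
                Complex.exp_add]; ring, norm_mul, norm_mul, Complex.norm_exp, Complex.norm_real,
            Real.norm_of_nonneg hr.le]
          have h1 := Complex.norm_exp_sub_one_le (x := d) (by linarith)
          have h2 : Real.exp (a + n * d).re * ‖Complex.exp d - 1‖ ≤ 4 * (2 * (1 / 32)) :=
            mul_le_mul e2 (by linarith) (norm_nonneg _) (by norm_num)
          nlinarith)
      have h3 := ih hn'
      rw [pow_succ]
      linarith
  have hfin := hind 256 le_rfl
  have hbd : a + ((256 : ℕ) : ℂ) * d = b := by rw [hd]; push_cast; ring
  rwa [hbd, hb] at hfin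

/-! ### Calculus of directional derivatives. -/

/-- The derivative of `u` in the direction `v`. -/
def pderiv (v : ℂ) (u : ℂ → ℝ) : ℂ → ℝ := fun z => fderiv ℝ u z v

/-- The Laplacian as the sum of the pure second partial derivatives. -/
def lap (u : ℂ → ℝ) : ℂ → ℝ := fun z =>
  pderiv 1 (pderiv 1 u) z + pderiv Complex.I (pderiv Complex.I u) z

section pderiv

variable {u w : ℂ → ℝ} {v v' z : ℂ}

theorem contDiffAt_pderiv (hu : ContDiffAt ℝ ∞ u z) (v : ℂ) : ContDiffAt ℝ ∞ (pderiv v u) z :=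
  (hu.fderiv_right (m := ∞) (by simp)).clm_apply contDiffAt_const

theorem contDiff_pderiv (hu : ContDiff ℝ ∞ u) (v : ℂ) : ContDiff ℝ ∞ (pderiv v u) :=
  contDiff_iff_contDiffAt.2 fun _ => contDiffAt_pderiv hu.contDiffAt v

theorem tsupport_pderiv_subset (v : ℂ) (u : ℂ → ℝ) : tsupport (pderiv v u) ⊆ tsupport u :=
  tsupport_fderiv_apply_subset ℝ v

theorem hasCompactSupport_pderiv (hu : HasCompactSupport u) (v : ℂ) :
    HasCompactSupport (pderiv v u) :=
  hu.fderiv_apply ℝ v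

theorem pderiv_congr (h : u =ᶠ[nhds z] w) : pderiv v u z = pderiv v w z := by
  simp only [pderiv, h.fderiv_eq]

theorem pderiv_eventuallyEq (h : u =ᶠ[nhds z] w) : pderiv v u =ᶠ[nhds z] pderiv v w := by
  filter_upwards [h.fderiv (𝕜 := ℝ)] with x hx
  simp only [pderiv, hx]

theorem lap_congr (h : u =ᶠ[nhds z] w) : lap u z = lap w z := by
  simp only [lap, pderiv_congr (pderiv_eventuallyEq h)]

theorem pderiv_comm (hu : ContDiff ℝ ∞ u) (v v' : ℂ) :
    pderiv v (pderiv v' u) = pderiv v' (pderiv v u) := by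
  have hd : Differentiable ℝ (fderiv ℝ u) :=
    (hu.fderiv_right (m := ∞) (by simp)).differentiable (by simp)
  have key : ∀ a b x, pderiv a (pderiv b u) x = fderiv ℝ (fderiv ℝ u) x a b := by
    intro a b x
    change fderiv ℝ (fun y => fderiv ℝ u y b) x a = _
    rw [fderiv_clm_apply (hd x) (differentiableAt_const b)]
    simp
  ext x
  rw [key, key]
  exact (hu.contDiffAt.isSymmSndFDerivAt (by
    rw [minSmoothness_of_isRCLikeNormedField]; exact WithTop.coe_le_coe.2 le_top)).eq v v'

theorem pderiv_add (hu : DifferentiableAt ℝ u z) (hw : DifferentiableAt ℝ w z) (v : ℂ) :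
    pderiv v (fun x => u x + w x) z = pderiv v u z + pderiv v w z := by
  simp only [pderiv]
  rw [fderiv_fun_add hu hw]
  rfl

theorem pderiv_mul (hu : DifferentiableAt ℝ u z) (hw : DifferentiableAt ℝ w z) (v : ℂ) :
    pderiv v (fun x => u x * w x) z = u z * pderiv v w z + pderiv v u z * w z := by
  simp only [pderiv]
  rw [fderiv_fun_mul hu hw]
  simp [mul_comm]

/-- The product rule where the first factor need only be differentiable on the support of the
second. -/
theorem pderiv_mul_of_tsupport (hu : z ∈ tsupport w → DifferentiableAt ℝ u z)
    (hw : DifferentiableAt ℝ w z) (v : ℂ) :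
    pderiv v (fun x => u x * w x) z = u z * pderiv v w z + pderiv v u z * w z := by
  by_cases hz : z ∈ tsupport w
  · exact pderiv_mul (hu hz) hw v
  · have h0 : w =ᶠ[nhds z] 0 := notMem_tsupport_iff_eventuallyEq.1 hz
    have h1 : (fun x => u x * w x) =ᶠ[nhds z] 0 := by
      filter_upwards [h0] with x hx; simp [hx]
    rw [pderiv_congr h1, pderiv_congr h0, h0.eq_of_nhds]
    simp [pderiv]

/-- This permits weights such as `z⁻ᵏ`, which are singular away from the support of the function
they multiply. -/
theorem contDiff_mul_of_tsupport (hu : ∀ z ∈ tsupport w, ContDiffAt ℝ ∞ u z)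
    (hw : ContDiff ℝ ∞ w) : ContDiff ℝ ∞ (fun x => u x * w x) := by
  rw [contDiff_iff_contDiffAt]
  intro z
  by_cases hz : z ∈ tsupport w
  · exact (hu z hz).mul hw.contDiffAt
  · have h1 : (fun x => u x * w x) =ᶠ[nhds z] fun _ => 0 := by
      filter_upwards [notMem_tsupport_iff_eventuallyEq.1 hz] with x hx; simp [hx]
    exact contDiffAt_const.congr_of_eventuallyEq h1

end pderiv

/-! ### Integration by parts and the Carleman inequality. -/

theorem integral_mul_pderiv {p q : ℂ → ℝ} (hp : ContDiff ℝ ∞ p) (hpc : HasCompactSupport p)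
    (hq : ContDiff ℝ ∞ q) (v : ℂ) :
    ∫ z, p z * pderiv v q z = - ∫ z, pderiv v p z * q z := by
  have hp' := contDiff_pderiv hp v
  have hq' := contDiff_pderiv hq v
  apply integral_mul_fderiv_eq_neg_fderiv_mul_of_integrable
  · exact (hp'.continuous.mul hq.continuous).integrable_of_hasCompactSupport
      (hasCompactSupport_pderiv hpc v).mul_right
  · exact (hp.continuous.mul hq'.continuous).integrable_of_hasCompactSupport hpc.mul_right
  · exact (hp.continuous.mul hq.continuous).integrable_of_hasCompactSupport hpc.mul_right
  · exact fun z _ => hp.differentiable (by simp) z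
  · exact fun z _ => hq.differentiable (by simp) z

/-- Poincaré's inequality. -/
theorem integral_sq_le_integral_pderiv_sq {p : ℂ → ℝ} {R : ℝ} (hp : ContDiff ℝ ∞ p)
    (hpc : HasCompactSupport p) (hR : tsupport p ⊆ closedBall 0 R) :
    ∫ z, p z ^ 2 ≤ 4 * R ^ 2 * ∫ z, pderiv 1 p z ^ 2 := by
  have hp' := contDiff_pderiv hp 1
  have hp2 : ContDiff ℝ ∞ (fun z => p z * p z) := hp.mul hp
  have hre : ContDiff ℝ ∞ Complex.re := Complex.reCLM.contDiff
  have hi : Integrable (fun z => p z ^ 2) := by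
    simp only [sq]
    exact (hp.continuous.mul hp.continuous).integrable_of_hasCompactSupport hpc.mul_right
  have hi' : Integrable (fun z => pderiv 1 p z ^ 2) := by
    simp only [sq]
    exact (hp'.continuous.mul hp'.continuous).integrable_of_hasCompactSupport
      (hasCompactSupport_pderiv hpc 1).mul_right
  -- Integrating `p²` against `∂₁ Re = 1` gives `∫ p² = -2 ∫ x p ∂₁p`. The right side is at most `½
  -- ∫ p² + 2R² ∫ (∂₁p)²`, and the first term is absorbed.
  have hparts := integral_mul_pderiv hp2 hpc.mul_right hre 1
  have h1 : ∀ z, pderiv 1 Complex.re z = 1 := fun z => by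
    have : fderiv ℝ Complex.re z = Complex.reCLM := Complex.reCLM.fderiv
    simp [pderiv, this]
  simp only [h1, mul_one] at hparts
  have h2 : ∀ z, pderiv 1 (fun z => p z * p z) z * z.re = 2 * z.re * p z * pderiv 1 p z := by
    intro z
    rw [pderiv_mul (hp.differentiable (by simp) z) (hp.differentiable (by simp) z)]
    ring
  simp only [h2] at hparts
  have h3 : ∫ z, p z * p z ≤ ∫ z, ((1 / 2) * p z ^ 2 + 2 * R ^ 2 * pderiv 1 p z ^ 2) := by
    rw [hparts, ← integral_neg]
    apply integral_mono
    · apply Integrable.neg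
      apply Continuous.integrable_of_hasCompactSupport
      · exact ((continuous_const.mul Complex.continuous_re).mul hp.continuous).mul hp'.continuous
      · exact (hasCompactSupport_pderiv hpc 1).mul_left
    · exact (hi.const_mul _).add (hi'.const_mul _)
    · intro z
      by_cases hz : z ∈ tsupport p
      · have hzR : ‖z‖ ≤ R := by simpa using hR hz
        have h4 : z.re ^ 2 ≤ R ^ 2 := by
          have := (Complex.abs_re_le_norm z).trans hzR
          nlinarith [abs_nonneg z.re, sq_abs z.re]
        have h5 : z.re ^ 2 * pderiv 1 p z ^ 2 ≤ R ^ 2 * pderiv 1 p z ^ 2 :=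
          mul_le_mul_of_nonneg_right h4 (sq_nonneg _)
        nlinarith [sq_nonneg (p z + 2 * (z.re * pderiv 1 p z))]
      · simp only [image_eq_zero_of_notMem_tsupport hz]
        have : 0 ≤ R ^ 2 * pderiv 1 p z ^ 2 := by positivity
        nlinarith
  rw [integral_add (hi.const_mul _) (hi'.const_mul _), integral_const_mul, integral_const_mul] at h3
  simp only [← sq] at h3
  linarith

/-- The `L²` bound for the Cauchy–Riemann operator on compactly supported functions. -/
theorem integral_sq_add_sq_le {p q : ℂ → ℝ} {R : ℝ} (hp : ContDiff ℝ ∞ p)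
    (hpc : HasCompactSupport p) (hpR : tsupport p ⊆ closedBall 0 R) (hq : ContDiff ℝ ∞ q)
    (hqc : HasCompactSupport q) (hqR : tsupport q ⊆ closedBall 0 R) :
    ∫ z, (p z ^ 2 + q z ^ 2) ≤ 4 * R ^ 2 * ∫ z, ((pderiv 1 p z - pderiv Complex.I q z) ^ 2
      + (pderiv 1 q z + pderiv Complex.I p z) ^ 2) := by
  have key : ∀ a b : ℂ → ℝ, ContDiff ℝ ∞ a → ContDiff ℝ ∞ b → HasCompactSupport a →
      Integrable (fun z => a z * b z) := fun a b ha hb hac =>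
    (ha.continuous.mul hb.continuous).integrable_of_hasCompactSupport hac.mul_right
  have hp1 := contDiff_pderiv hp 1
  have hp2 := contDiff_pderiv hp Complex.I
  have hq1 := contDiff_pderiv hq 1
  have hq2 := contDiff_pderiv hq Complex.I
  have cp1 := hasCompactSupport_pderiv hpc 1
  have cp2 := hasCompactSupport_pderiv hpc Complex.I
  have cq1 := hasCompactSupport_pderiv hqc 1
  have cq2 := hasCompactSupport_pderiv hqc Complex.I
  -- The cross terms of `|(∂x + i∂y)(p + iq)|²` cancel on integration, leaving the full gradients of
  -- `p` and `q`, to which Poincaré's inequality applies.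
  have hcross : ∫ z, pderiv 1 p z * pderiv Complex.I q z
      = ∫ z, pderiv Complex.I p z * pderiv 1 q z := by
    rw [integral_mul_pderiv hp1 cp1 hq, integral_mul_pderiv hp2 cp2 hq, pderiv_comm hp]
  have h1 := integral_sq_le_integral_pderiv_sq hp hpc hpR
  have h2 := integral_sq_le_integral_pderiv_sq hq hqc hqR
  have e : ∫ z, ((pderiv 1 p z - pderiv Complex.I q z) ^ 2
      + (pderiv 1 q z + pderiv Complex.I p z) ^ 2)
      = (∫ z, pderiv 1 p z ^ 2) + (∫ z, pderiv 1 q z ^ 2)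
        + (∫ z, pderiv Complex.I p z ^ 2) + (∫ z, pderiv Complex.I q z ^ 2)
        - 2 * (∫ z, pderiv 1 p z * pderiv Complex.I q z)
        + 2 * (∫ z, pderiv Complex.I p z * pderiv 1 q z) := by
    have i1 := key _ _ hp1 hp1 cp1
    have i2 := key _ _ hq1 hq1 cq1
    have i3 := key _ _ hp2 hp2 cp2
    have i4 := key _ _ hq2 hq2 cq2
    have i5 := (key _ _ hp1 hq2 cp1).const_mul 2
    have i6 := (key _ _ hp2 hq1 cp2).const_mul 2
    rw [← integral_const_mul, ← integral_const_mul]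
    simp only [sq]
    have add' : ∀ {k l : ℂ → ℝ}, Integrable k → Integrable l → Integrable (fun z => k z + l z) :=
      fun h h' => h.add h'
    have sub' : ∀ {k l : ℂ → ℝ}, Integrable k → Integrable l → Integrable (fun z => k z - l z) :=
      fun h h' => h.sub h'
    rw [← integral_add i1 i2, ← integral_add (add' i1 i2) i3,
      ← integral_add (add' (add' i1 i2) i3) i4, ← integral_sub (add' (add' (add' i1 i2) i3) i4) i5,
      ← integral_add (sub' (add' (add' (add' i1 i2) i3) i4) i5) i6]
    congr 1; ext z; ring
  rw [e, hcross]
  have i1 := key _ _ hp hp hpc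
  have i2 := key _ _ hq hq hqc
  simp only [← sq] at i1 i2
  rw [integral_add i1 i2]
  have n1 : 0 ≤ ∫ z, pderiv Complex.I p z ^ 2 := integral_nonneg fun z => sq_nonneg _
  have n2 : 0 ≤ ∫ z, pderiv Complex.I q z ^ 2 := integral_nonneg fun z => sq_nonneg _
  have n3 : 0 ≤ 4 * R ^ 2 := by positivity
  nlinarith

/-- A Carleman inequality for the Laplacian with weight `‖g‖²`, `g` holomorphic near the support
of `u`. -/
theorem carleman {u : ℂ → ℝ} {g : ℂ → ℂ} {R : ℝ} (hu : ContDiff ℝ ∞ u)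
    (huc : HasCompactSupport u) (huR : tsupport u ⊆ closedBall 0 R)
    (hg : ∀ z ∈ tsupport u, AnalyticAt ℂ g z) :
    ∫ z, ‖g z‖ ^ 2 * u z ^ 2 ≤ 16 * R ^ 4 * ∫ z, ‖g z‖ ^ 2 * lap u z ^ 2 := by
  set a : ℂ → ℝ := fun z => (g z).re with ha
  set b : ℂ → ℝ := fun z => (g z).im with hb
  have hgR : ∀ z ∈ tsupport u, ContDiffAt ℝ ∞ g z := fun z hz =>
    ((hg z hz).contDiffAt (n := ∞)).restrict_scalars ℝ
  have hac : ∀ z ∈ tsupport u, ContDiffAt ℝ ∞ a z := fun z hz =>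
    Complex.reCLM.contDiff.contDiffAt.comp z (hgR z hz)
  have hbc : ∀ z ∈ tsupport u, ContDiffAt ℝ ∞ b z := fun z hz =>
    Complex.imCLM.contDiff.contDiffAt.comp z (hgR z hz)
  have had : ∀ z ∈ tsupport u, DifferentiableAt ℝ a z := fun z hz =>
    (hac z hz).differentiableAt (by simp)
  have hbd : ∀ z ∈ tsupport u, DifferentiableAt ℝ b z := fun z hz =>
    (hbc z hz).differentiableAt (by simp)
  have hfd : ∀ z ∈ tsupport u, ∀ v, pderiv v a z = (v * deriv g z).re ∧
      pderiv v b z = (v * deriv g z).im := by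
    intro z hz v
    have h1 : HasFDerivAt g ((ContinuousLinearMap.toSpanSingleton ℂ
        (deriv g z)).restrictScalars ℝ) z :=
      (hg z hz).differentiableAt.hasDerivAt.hasFDerivAt.restrictScalars ℝ
    have h2 : HasFDerivAt a _ z := Complex.reCLM.hasFDerivAt.comp z h1
    have h3 : HasFDerivAt b _ z := Complex.imCLM.hasFDerivAt.comp z h1
    constructor
    · simp only [pderiv, h2.fderiv]; simp
    · simp only [pderiv, h3.fderiv]; simp
  have hCR : ∀ z ∈ tsupport u, pderiv 1 a z = pderiv Complex.I b z ∧
      pderiv 1 b z = - pderiv Complex.I a z := by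
    intro z hz
    rw [(hfd z hz 1).1, (hfd z hz 1).2, (hfd z hz Complex.I).1, (hfd z hz Complex.I).2]
    simp
  have hnorm : ∀ z, ‖g z‖ ^ 2 = a z ^ 2 + b z ^ 2 := fun z => by
    rw [Complex.sq_norm, Complex.normSq_apply]; ring
  have hu1 := contDiff_pderiv hu 1
  have hu2 := contDiff_pderiv hu Complex.I
  have s1 := tsupport_pderiv_subset 1 u
  have s2 := tsupport_pderiv_subset Complex.I u
  have c1 := hasCompactSupport_pderiv huc 1
  have c2 := hasCompactSupport_pderiv huc Complex.I
  have hsm : ∀ (k l : ℂ → ℝ), tsupport (fun z => k z * l z) ⊆ tsupport l := fun k l =>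
    tsupport_mul_subset_right (f := k) (g := l)
  have dz : ∀ {w : ℂ → ℝ}, ContDiff ℝ ∞ w → ∀ z, DifferentiableAt ℝ w z := fun h z =>
    h.differentiable (by simp) z
  -- the function `g u`
  have A := integral_sq_add_sq_le (p := fun z => a z * u z) (q := fun z => b z * u z) (R := R)
    (contDiff_mul_of_tsupport hac hu) huc.mul_left ((hsm a u).trans huR)
    (contDiff_mul_of_tsupport hbc hu) huc.mul_left ((hsm b u).trans huR)
  have eA1 : ∀ z, (a z * u z) ^ 2 + (b z * u z) ^ 2 = ‖g z‖ ^ 2 * u z ^ 2 := fun z => by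
    rw [hnorm]; ring
  -- The Cauchy–Riemann equations for `g` turn `(∂x + i∂y)(g u)` into `g (u_x + i u_y)`.
  have eA2 : ∀ z, (pderiv 1 (fun z => a z * u z) z - pderiv Complex.I (fun z => b z * u z) z) ^ 2
      + (pderiv 1 (fun z => b z * u z) z + pderiv Complex.I (fun z => a z * u z) z) ^ 2
      = ‖g z‖ ^ 2 * (pderiv 1 u z ^ 2 + pderiv Complex.I u z ^ 2) := by
    intro z
    rw [pderiv_mul_of_tsupport (had z) (dz hu z), pderiv_mul_of_tsupport (had z) (dz hu z),
      pderiv_mul_of_tsupport (hbd z) (dz hu z), pderiv_mul_of_tsupport (hbd z) (dz hu z), hnorm]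
    by_cases hz : z ∈ tsupport u
    · rw [(hCR z hz).1, (hCR z hz).2]; ring
    · rw [image_eq_zero_of_notMem_tsupport hz]; ring
  simp only [eA1, eA2] at A
  -- the function `conj g * (u_x + i u_y)`
  have B := integral_sq_add_sq_le
    (p := fun z => a z * pderiv 1 u z + b z * pderiv Complex.I u z)
    (q := fun z => b z * pderiv 1 u z + (-a z) * pderiv Complex.I u z) (R := R)
    ((contDiff_mul_of_tsupport (fun z hz => hac z (s1 hz)) hu1).add
      (contDiff_mul_of_tsupport (fun z hz => hbc z (s2 hz)) hu2))
    (c1.mul_left.add c2.mul_left)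
    ((tsupport_add _ _).trans (union_subset (((hsm a _).trans s1).trans huR)
      (((hsm b _).trans s2).trans huR)))
    ((contDiff_mul_of_tsupport (fun z hz => hbc z (s1 hz)) hu1).add
      (contDiff_mul_of_tsupport (fun z hz => (hac z (s2 hz)).neg) hu2))
    (c1.mul_left.add c2.mul_left)
    ((tsupport_add _ _).trans (union_subset (((hsm b _).trans s1).trans huR)
      (((hsm (fun z => -a z) _).trans s2).trans huR)))
  have eB1 : ∀ z, (a z * pderiv 1 u z + b z * pderiv Complex.I u z) ^ 2
      + (b z * pderiv 1 u z + (-a z) * pderiv Complex.I u z) ^ 2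
      = ‖g z‖ ^ 2 * (pderiv 1 u z ^ 2 + pderiv Complex.I u z ^ 2) := fun z => by
    rw [hnorm]; ring
  have hpa : ∀ (v z : ℂ) (k l : ℂ → ℝ), (∀ z ∈ tsupport u, ContDiffAt ℝ ∞ k z) →
      (∀ z ∈ tsupport u, ContDiffAt ℝ ∞ l z) →
      pderiv v (fun z => k z * pderiv 1 u z + l z * pderiv Complex.I u z) z
      = k z * pderiv v (pderiv 1 u) z + pderiv v k z * pderiv 1 u z
        + (l z * pderiv v (pderiv Complex.I u) z + pderiv v l z * pderiv Complex.I u z) := by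
    intro v z k l hk hl
    have e1 := pderiv_mul_of_tsupport (z := z) (fun hz => (hk z (s1 hz)).differentiableAt (by simp))
      (dz hu1 z) v
    have e2 := pderiv_mul_of_tsupport (z := z) (fun hz => (hl z (s2 hz)).differentiableAt (by simp))
      (dz hu2 z) v
    rw [← e1, ← e2]
    exact pderiv_add (dz (contDiff_mul_of_tsupport (fun z hz => hk z (s1 hz)) hu1) z)
      (dz (contDiff_mul_of_tsupport (fun z hz => hl z (s2 hz)) hu2) z) v
  have hneg : ∀ v z, pderiv v (fun z => -a z) z = - pderiv v a z := fun v z => by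
    simp only [pderiv, fderiv_fun_neg]; rfl
  -- Here `p + iq = g (u_x - i u_y)`. The operator `∂x + i∂y` passes through `g`, and symmetry of
  -- second derivatives leaves `g Δu`.
  have eB2 : ∀ z, (pderiv 1 (fun z => a z * pderiv 1 u z + b z * pderiv Complex.I u z) z
      - pderiv Complex.I (fun z => b z * pderiv 1 u z + (-a z) * pderiv Complex.I u z) z) ^ 2
      + (pderiv 1 (fun z => b z * pderiv 1 u z + (-a z) * pderiv Complex.I u z) z
      + pderiv Complex.I (fun z => a z * pderiv 1 u z + b z * pderiv Complex.I u z) z) ^ 2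
      = ‖g z‖ ^ 2 * lap u z ^ 2 := by
    intro z
    rw [hpa 1 z a b hac hbc, hpa Complex.I z a b hac hbc,
      hpa 1 z b (fun z => -a z) hbc (fun z hz => (hac z hz).neg),
      hpa Complex.I z b (fun z => -a z) hbc (fun z hz => (hac z hz).neg), hnorm, hneg, hneg, lap,
      pderiv_comm hu 1 Complex.I]
    by_cases hz : z ∈ tsupport u
    · rw [(hCR z hz).1, (hCR z hz).2]; ring
    · rw [image_eq_zero_of_notMem_tsupport (fun h => hz (s1 h)),
        image_eq_zero_of_notMem_tsupport (fun h => hz (s2 h))]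
      ring
  simp only [eB1, eB2] at B
  have hR : 0 ≤ 4 * R ^ 2 := by positivity
  calc ∫ z, ‖g z‖ ^ 2 * u z ^ 2
      ≤ 4 * R ^ 2 * ∫ z, ‖g z‖ ^ 2 * (pderiv 1 u z ^ 2 + pderiv Complex.I u z ^ 2) := A
    _ ≤ 4 * R ^ 2 * (4 * R ^ 2 * ∫ z, ‖g z‖ ^ 2 * lap u z ^ 2) :=
        mul_le_mul_of_nonneg_left B hR
    _ = _ := by ring

/-! ### The Laplacian of a product and scale-invariant cutoff bounds. -/

theorem pderiv_mul_eventuallyEq {u w : ℂ → ℝ} {z : ℂ} (hu : ContDiffAt ℝ ∞ u z)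
    (hw : ContDiffAt ℝ ∞ w z) (v : ℂ) :
    pderiv v (fun x => u x * w x) =ᶠ[nhds z] fun x => u x * pderiv v w x + pderiv v u x * w x := by
  have h1 : (1 : WithTop ℕ∞) ≤ ((⊤ : ℕ∞) : WithTop ℕ∞) := WithTop.coe_le_coe.2 le_top
  filter_upwards [(hu.of_le h1).eventually (by simp), (hw.of_le h1).eventually (by simp)]
    with x hx hx'
  exact pderiv_mul (hx.differentiableAt (by simp)) (hx'.differentiableAt (by simp)) v

theorem lap_mul {u w : ℂ → ℝ} {z : ℂ} (hu : ContDiffAt ℝ ∞ u z) (hw : ContDiffAt ℝ ∞ w z) :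
    lap (fun x => u x * w x) z = u z * lap w z + lap u z * w z
      + 2 * (pderiv 1 u z * pderiv 1 w z + pderiv Complex.I u z * pderiv Complex.I w z) := by
  have dd : ∀ {k : ℂ → ℝ}, ContDiffAt ℝ ∞ k z → DifferentiableAt ℝ k z := fun h =>
    h.differentiableAt (by simp)
  have key : ∀ v : ℂ, pderiv v (pderiv v (fun x => u x * w x)) z
      = u z * pderiv v (pderiv v w) z + pderiv v (pderiv v u) z * w z
        + 2 * (pderiv v u z * pderiv v w z) := by
    intro v
    have hu' := contDiffAt_pderiv hu v
    have hw' := contDiffAt_pderiv hw v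
    rw [pderiv_congr (pderiv_mul_eventuallyEq hu hw v), pderiv_add (dd (hu.mul hw'))
      (dd (hu'.mul hw)), pderiv_mul (dd hu) (dd hw'), pderiv_mul (dd hu') (dd hw)]
    ring
  simp only [lap, key]
  ring

theorem contDiffAt_of_harmonicAt {f : ℂ → ℝ} {z : ℂ} (hf : HarmonicAt f z) :
    ContDiffAt ℝ ∞ f z :=
  (HarmonicAt.analyticAt hf).contDiffAt

theorem lap_eq_zero_of_harmonicAt {f : ℂ → ℝ} {z : ℂ} (hf : HarmonicAt f z) : lap f z = 0 := by
  have h := hf.2.eq_of_nhds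
  have hd : DifferentiableAt ℝ (fderiv ℝ f) z :=
    ((contDiffAt_of_harmonicAt hf).fderiv_right (m := ∞) (by simp)).differentiableAt (by simp)
  have key : ∀ b, pderiv b (pderiv b f) z = fderiv ℝ (fderiv ℝ f) z b b := by
    intro b
    change fderiv ℝ (fun y => fderiv ℝ f y b) z b = _
    rw [fderiv_clm_apply hd (differentiableAt_const b)]
    simp
  rw [laplacian_eq_iteratedFDeriv_complexPlane] at h
  simp only [iteratedFDeriv_two_apply, Matrix.cons_val_zero, Matrix.cons_val_one,
    Pi.zero_apply] at h
  rw [lap, key, key]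
  exact h

/-- Bounds for a cutoff function and its first and second derivatives at scale `r`. -/
def CutoffBound (K r : ℝ) (η : ℂ → ℝ) (z : ℂ) : Prop :=
  |η z| ≤ 1 ∧ |pderiv 1 η z| ≤ K / r ∧ |pderiv Complex.I η z| ≤ K / r ∧ |lap η z| ≤ K / r ^ 2

theorem CutoffBound.congr {K r : ℝ} {η θ : ℂ → ℝ} {z : ℂ} (h : CutoffBound K r η z)
    (he : θ =ᶠ[nhds z] η) : CutoffBound K r θ z := by
  unfold CutoffBound
  rwa [he.eq_of_nhds, pderiv_congr he, pderiv_congr he, lap_congr he]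

theorem CutoffBound.of_one {K r : ℝ} {η : ℂ → ℝ} {z : ℂ} (h : CutoffBound K 1 η z)
    (hr : 0 < r) (hr1 : r ≤ 1) : CutoffBound K r η z := by
  obtain ⟨h0, h1, h2, h3⟩ := h
  have hK : 0 ≤ K := by simpa using (abs_nonneg _).trans h1
  refine ⟨h0, h1.trans ?_, h2.trans ?_, h3.trans ?_⟩
  · exact div_le_div_of_nonneg_left hK hr hr1
  · exact div_le_div_of_nonneg_left hK hr hr1
  · exact div_le_div_of_nonneg_left hK (by positivity) (by nlinarith)

theorem abs_mul_add_mul_le {a b c d A B C D : ℝ} (ha : |a| ≤ A) (hb : |b| ≤ B) (hc : |c| ≤ C)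
    (hd : |d| ≤ D) : |a * b + c * d| ≤ A * B + C * D := by
  refine (abs_add_le _ _).trans (add_le_add ?_ ?_) <;> rw [abs_mul]
  · exact mul_le_mul ha hb (abs_nonneg _) ((abs_nonneg _).trans ha)
  · exact mul_le_mul hc hd (abs_nonneg _) ((abs_nonneg _).trans hc)

theorem CutoffBound.mul {K K' r : ℝ} {η θ : ℂ → ℝ} {z : ℂ} (h : CutoffBound K r η z)
    (h' : CutoffBound K' r θ z) (hη : ContDiffAt ℝ ∞ η z) (hθ : ContDiffAt ℝ ∞ θ z)
    (hr : 0 < r) : CutoffBound (K + K' + 4 * K * K') r (fun x => η x * θ x) z := by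
  obtain ⟨h0, h1, h2, h3⟩ := h
  obtain ⟨h0', h1', h2', h3'⟩ := h'
  have hK : 0 ≤ K := by
    have := (abs_nonneg _).trans h1; rwa [le_div_iff₀ hr, zero_mul] at this
  have hK' : 0 ≤ K' := by
    have := (abs_nonneg _).trans h1'; rwa [le_div_iff₀ hr, zero_mul] at this
  have hKK : 0 ≤ K * K' := mul_nonneg hK hK'
  have dη : DifferentiableAt ℝ η z := hη.differentiableAt (by simp)
  have dθ : DifferentiableAt ℝ θ z := hθ.differentiableAt (by simp)
  refine ⟨?_, ?_, ?_, ?_⟩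
  · rw [abs_mul]; exact mul_le_one₀ h0 (abs_nonneg _) h0'
  · rw [pderiv_mul dη dθ]
    refine (abs_mul_add_mul_le h0 h1' h1 h0').trans ?_
    rw [one_mul, mul_one, ← add_div]
    exact div_le_div_of_nonneg_right (by linarith) hr.le
  · rw [pderiv_mul dη dθ]
    refine (abs_mul_add_mul_le h0 h2' h2 h0').trans ?_
    rw [one_mul, mul_one, ← add_div]
    exact div_le_div_of_nonneg_right (by linarith) hr.le
  · rw [lap_mul hη hθ]
    refine (abs_add_le _ _).trans ((add_le_add (abs_mul_add_mul_le h0 h3' h3 h0') ?_).trans_eq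
      (?_ : _ + 2 * (K / r * (K' / r) + K / r * (K' / r)) = _))
    · rw [abs_mul, abs_two]
      exact mul_le_mul_of_nonneg_left (abs_mul_add_mul_le h1 h1' h2 h2') (by norm_num)
    · field_simp; ring

/-- Harmonicity leaves `Δ(ηf) = f Δη + 2 ∇η·∇f`, so every term carries a derivative of `η`. The
bracket on the right is the later `energy`. -/
theorem CutoffBound.sq_lap_mul_le {K r : ℝ} {η f : ℂ → ℝ} {z : ℂ} (h : CutoffBound K r η z)
    (hη : ContDiffAt ℝ ∞ η z) (hf : HarmonicAt f z) (hr : 0 < r) :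
    lap (fun x => η x * f x) z ^ 2
      ≤ 12 * K ^ 2 / r ^ 4 *
        (f z ^ 2 + r ^ 2 * (pderiv 1 f z ^ 2 + pderiv Complex.I f z ^ 2)) := by
  obtain ⟨-, h1, h2, h3⟩ := h
  rw [lap_mul hη (contDiffAt_of_harmonicAt hf), lap_eq_zero_of_harmonicAt hf, mul_zero, zero_add]
  set a := lap η z
  set b := pderiv 1 η z
  set c := pderiv Complex.I η z
  set F := f z
  set G := pderiv 1 f z
  set H := pderiv Complex.I f z
  have e1 : a ^ 2 ≤ K ^ 2 / r ^ 4 := by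
    rw [← sq_abs, show K ^ 2 / r ^ 4 = (K / r ^ 2) ^ 2 by field_simp]
    exact pow_le_pow_left₀ (abs_nonneg _) h3 2
  have e2 : b ^ 2 ≤ K ^ 2 / r ^ 4 * r ^ 2 := by
    rw [← sq_abs, show K ^ 2 / r ^ 4 * r ^ 2 = (K / r) ^ 2 by field_simp]
    exact pow_le_pow_left₀ (abs_nonneg _) h1 2
  have e3 : c ^ 2 ≤ K ^ 2 / r ^ 4 * r ^ 2 := by
    rw [← sq_abs, show K ^ 2 / r ^ 4 * r ^ 2 = (K / r) ^ 2 by field_simp]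
    exact pow_le_pow_left₀ (abs_nonneg _) h2 2
  have e4 := mul_le_mul_of_nonneg_right e1 (sq_nonneg F)
  have e5 := mul_le_mul_of_nonneg_right e2 (sq_nonneg G)
  have e6 := mul_le_mul_of_nonneg_right e3 (sq_nonneg H)
  have e7 : (a * F + 2 * (b * G + c * H)) ^ 2
      ≤ 3 * ((a * F) ^ 2 + 4 * (b * G) ^ 2 + 4 * (c * H) ^ 2) := by
    nlinarith [sq_nonneg (a * F - 2 * (b * G)), sq_nonneg (a * F - 2 * (c * H)),
      sq_nonneg (2 * (b * G) - 2 * (c * H))]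
  refine e7.trans ?_
  have : 0 ≤ K ^ 2 / r ^ 4 * F ^ 2 := by positivity
  rw [show 12 * K ^ 2 / r ^ 4 = 12 * (K ^ 2 / r ^ 4) by ring]
  nlinarith

/-- Subtracting the constant `c` covers both bumps (`c = 0`) and functions equal to 1 far out (`c =
1`). -/
theorem exists_cutoffBound {η : ℂ → ℝ} (hη : ContDiff ℝ ∞ η) (h1 : ∀ z, |η z| ≤ 1) (c : ℝ)
    (hc : HasCompactSupport fun z => η z - c) : ∃ K : ℝ, 0 ≤ K ∧ ∀ z, CutoffBound K 1 η z := by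
  have hsub : ∀ v, pderiv v η = pderiv v (fun z => η z - c) := fun v => by
    ext z; simp only [pderiv, fderiv_sub_const]
  have c1 : ∀ v, HasCompactSupport (pderiv v η) := fun v => by
    rw [hsub]; exact hasCompactSupport_pderiv hc v
  have s1 := fun v => contDiff_pderiv hη v
  obtain ⟨A, hA⟩ := (c1 1).exists_bound_of_continuous (s1 1).continuous
  obtain ⟨B, hB⟩ := (c1 Complex.I).exists_bound_of_continuous (s1 Complex.I).continuous
  obtain ⟨C, hC⟩ := (hasCompactSupport_pderiv (c1 1) 1).exists_bound_of_continuous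
    (contDiff_pderiv (s1 1) 1).continuous
  obtain ⟨D, hD⟩ := (hasCompactSupport_pderiv (c1 Complex.I) Complex.I).exists_bound_of_continuous
    (contDiff_pderiv (s1 Complex.I) Complex.I).continuous
  simp only [Real.norm_eq_abs] at hA hB hC hD
  have A0 := (abs_nonneg _).trans (hA 0)
  have B0 := (abs_nonneg _).trans (hB 0)
  have C0 := (abs_nonneg _).trans (hC 0)
  have D0 := (abs_nonneg _).trans (hD 0)
  refine ⟨A + B + C + D, by positivity, fun z => ⟨h1 z, ?_, ?_, ?_⟩⟩
  · linarith [hA z]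
  · linarith [hB z]
  · rw [one_pow, div_one]
    exact (abs_add_le _ _).trans (by linarith [hC z, hD z])

theorem pderiv_rescale (u : ℂ → ℝ) (r : ℝ) (w v z : ℂ) :
    pderiv v (fun x => u (r • (x - w))) z = r * pderiv v u (r • (z - w)) := by
  simp only [pderiv]
  rw [fderiv_comp_sub (f := fun x => u (r • x)) (a := w), fderiv_comp_smul]
  rfl

theorem lap_rescale (u : ℂ → ℝ) (r : ℝ) (w z : ℂ) :
    lap (fun x => u (r • (x - w))) z = r ^ 2 * lap u (r • (z - w)) := by
  have key : ∀ v, pderiv v (pderiv v (fun x => u (r • (x - w)))) z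
      = r ^ 2 * pderiv v (pderiv v u) (r • (z - w)) := by
    intro v
    have h : pderiv v (fun x => u (r • (x - w))) = fun z => r * pderiv v u (r • (z - w)) :=
      funext (pderiv_rescale u r w v)
    rw [h]
    have h2 : pderiv v (fun z => r * pderiv v u (r • (z - w))) z
        = r * pderiv v (fun z => pderiv v u (r • (z - w))) z := by
      change fderiv ℝ (r • fun z => pderiv v u (r • (z - w))) z v = _
      rw [fderiv_const_smul_field]; rfl
    rw [h2, pderiv_rescale]
    ring
  simp only [lap, key]
  ring

theorem CutoffBound.rescale {K r : ℝ} {η : ℂ → ℝ} {w z : ℂ} (hr : 0 < r)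
    (h : CutoffBound K 1 η (r⁻¹ • (z - w))) :
    CutoffBound K r (fun x => η (r⁻¹ • (x - w))) z := by
  obtain ⟨h0, h1, h2, h3⟩ := h
  simp only [one_pow, div_one] at h1 h2 h3
  refine ⟨h0, ?_, ?_, ?_⟩
  · rw [pderiv_rescale, abs_mul, abs_of_pos (inv_pos.2 hr), div_eq_inv_mul]
    exact mul_le_mul_of_nonneg_left h1 (inv_pos.2 hr).le
  · rw [pderiv_rescale, abs_mul, abs_of_pos (inv_pos.2 hr), div_eq_inv_mul]
    exact mul_le_mul_of_nonneg_left h2 (inv_pos.2 hr).le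
  · rw [lap_rescale, abs_mul, abs_of_pos (by positivity), div_eq_inv_mul, inv_pow]
    exact mul_le_mul_of_nonneg_left h3 (by positivity)

/-! ### The cutoff around the holes. -/

/-- A smooth radial function vanishing on `‖v‖ ≤ 2` and equal to `1` on `‖v‖ ≥ 3`. -/
def radialStep (v : ℂ) : ℝ := Real.smoothTransition ((‖v‖ ^ 2 - 4) / 5)

theorem contDiff_radialStep : ContDiff ℝ ∞ radialStep :=
  Real.smoothTransition.contDiff.comp (((contDiff_norm_sq ℝ).sub contDiff_const).div_const _)

theorem radialStep_eq_zero {v : ℂ} (h : ‖v‖ ≤ 2) : radialStep v = 0 :=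
  Real.smoothTransition.zero_of_nonpos (by nlinarith [norm_nonneg v])

theorem radialStep_eq_one {v : ℂ} (h : 3 ≤ ‖v‖) : radialStep v = 1 :=
  Real.smoothTransition.one_of_one_le (by nlinarith [norm_nonneg v])

theorem abs_smoothTransition_le_one (x : ℝ) : |Real.smoothTransition x| ≤ 1 := by
  rw [abs_of_nonneg (Real.smoothTransition.nonneg x)]
  exact Real.smoothTransition.le_one x

theorem exists_cutoffBound_radialStep :
    ∃ K : ℝ, 0 ≤ K ∧ ∀ z, CutoffBound K 1 radialStep z := by
  apply exists_cutoffBound contDiff_radialStep (fun z => abs_smoothTransition_le_one _) 1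
  apply HasCompactSupport.of_support_subset_isCompact (isCompact_closedBall (0 : ℂ) 3)
  intro v hv
  by_contra h
  simp only [mem_closedBall, dist_zero_right, not_le] at h
  exact hv (by simp [radialStep_eq_one h.le])

theorem norm_rescale {r : ℝ} (hr : 0 < r) (z w : ℂ) : ‖r⁻¹ • (z - w)‖ = dist z w / r := by
  rw [norm_smul, dist_eq_norm, Real.norm_of_nonneg (inv_pos.2 hr).le, div_eq_inv_mul]

/-- The points of `Z` are at mutual distance at least `100 r`. -/
def SeparatedAt (r : ℝ) (Z : Set ℂ) : Prop := ∀ z ∈ Z, ∀ w ∈ Z, z ≠ w → 100 * r ≤ dist z w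

open Classical in
/-- A function vanishing on the discs of radius `2r` about the points of `Z` and equal to `1`
outside those of radius `3r`. -/
def holeCutoff (r : ℝ) (Z : Set ℂ) (z : ℂ) : ℝ :=
  if h : ∃ w ∈ Z, dist z w < 4 * r then radialStep (r⁻¹ • (z - h.choose)) else 1

section holeCutoff

variable {r : ℝ} {Z : Set ℂ} {z w : ℂ}

theorem holeCutoff_eq_radialStep (hr : 0 < r)
    (hsep : SeparatedAt r Z) (hw : w ∈ Z)
    (hz : dist z w < 50 * r) : holeCutoff r Z z = radialStep (r⁻¹ • (z - w)) := by
  unfold holeCutoff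
  split_ifs with h
  · obtain ⟨h1, h2⟩ := h.choose_spec
    have : h.choose = w := by
      by_contra hne
      have := hsep _ h1 _ hw hne
      have := dist_triangle_left h.choose w z
      linarith
    rw [this]
  · push Not at h
    rw [radialStep_eq_one]
    rw [norm_rescale hr, le_div_iff₀ hr]
    linarith [h w hw]

theorem holeCutoff_eq_one_of_far (h : ∀ w ∈ Z, 4 * r ≤ dist z w) : holeCutoff r Z z = 1 := by
  unfold holeCutoff
  rw [dif_neg]
  push Not
  exact h

theorem holeCutoff_eventuallyEq_radialStep (hr : 0 < r)
    (hsep : SeparatedAt r Z) (hw : w ∈ Z)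
    (hz : dist z w < 50 * r) :
    holeCutoff r Z =ᶠ[nhds z] fun x => radialStep (r⁻¹ • (x - w)) := by
  filter_upwards [isOpen_ball.mem_nhds (show z ∈ ball w (50 * r) from hz)] with x hx
  exact holeCutoff_eq_radialStep hr hsep hw hx

theorem holeCutoff_eventuallyEq_one_of_far (hr : 0 < r) (h : ∀ w ∈ Z, 50 * r ≤ dist z w) :
    holeCutoff r Z =ᶠ[nhds z] fun _ => 1 := by
  filter_upwards [ball_mem_nhds z hr] with x hx
  apply holeCutoff_eq_one_of_far
  intro w hw
  have := h w hw
  have := dist_triangle_left z w x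
  rw [mem_ball] at hx
  linarith

theorem contDiff_holeCutoff (hr : 0 < r)
    (hsep : SeparatedAt r Z) : ContDiff ℝ ∞ (holeCutoff r Z) := by
  rw [contDiff_iff_contDiffAt]
  intro z
  by_cases h : ∃ w ∈ Z, dist z w < 50 * r
  · obtain ⟨w, hw, hz⟩ := h
    refine ContDiffAt.congr_of_eventuallyEq ?_ (holeCutoff_eventuallyEq_radialStep hr hsep hw hz)
    have haff : ContDiff ℝ ∞ (fun x : ℂ => r⁻¹ • (x - w)) := by fun_prop
    exact (contDiff_radialStep.comp haff).contDiffAt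
  · push Not at h
    exact contDiffAt_const.congr_of_eventuallyEq (holeCutoff_eventuallyEq_one_of_far hr h)

/-- The separation makes at most one hole relevant near any point, so the constant of a single
radial profile serves for every `Z`; rescaling supplies the powers of `r`. -/
theorem cutoffBound_holeCutoff {K : ℝ} (hK : 0 ≤ K) (hb : ∀ z, CutoffBound K 1 radialStep z)
    (hr : 0 < r) (hsep : SeparatedAt r Z) (z : ℂ) :
    CutoffBound K r (holeCutoff r Z) z := by
  by_cases h : ∃ w ∈ Z, dist z w < 50 * r
  · obtain ⟨w, hw, hz⟩ := h
    have h1 : CutoffBound K r (fun x => radialStep (r⁻¹ • (x - w))) z :=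
      CutoffBound.rescale (η := radialStep) hr (hb (r⁻¹ • (z - w)))
    exact h1.congr (holeCutoff_eventuallyEq_radialStep hr hsep hw hz)
  · push Not at h
    refine CutoffBound.congr ?_ (holeCutoff_eventuallyEq_one_of_far hr h)
    have hp : ∀ v, pderiv v (fun _ => (1 : ℝ)) = fun _ => 0 := fun v => by
      ext x; simp [pderiv]
    have hp0 : ∀ v, pderiv v (fun _ => (0 : ℝ)) = fun _ => 0 := fun v => by
      ext x; simp [pderiv]
    have : 0 ≤ K / r := by positivity
    have : 0 ≤ K / r ^ 2 := by positivity
    refine ⟨by simp, ?_, ?_, ?_⟩ <;> simpa [hp, hp0, lap]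

theorem holeCutoff_eventuallyEq_zero (hr : 0 < r)
    (hsep : SeparatedAt r Z) (hw : w ∈ Z)
    (hz : dist z w < 2 * r) : holeCutoff r Z =ᶠ[nhds z] fun _ => 0 := by
  filter_upwards [isOpen_ball.mem_nhds (show z ∈ ball w (2 * r) from hz)] with x hx
  rw [mem_ball] at hx
  rw [holeCutoff_eq_radialStep hr hsep hw (by linarith)]
  apply radialStep_eq_zero
  rw [norm_rescale hr, div_le_iff₀ hr]
  exact hx.le

theorem holeCutoff_eq_one (hr : 0 < r)
    (hsep : SeparatedAt r Z)
    (hz : ∀ w ∈ Z, 3 * r ≤ dist z w) : holeCutoff r Z z = 1 := by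
  by_cases h : ∃ w ∈ Z, dist z w < 50 * r
  · obtain ⟨w, hw, hzw⟩ := h
    rw [holeCutoff_eq_radialStep hr hsep hw hzw]
    apply radialStep_eq_one
    rw [norm_rescale hr, le_div_iff₀ hr]
    exact hz w hw
  · push Not at h
    exact holeCutoff_eq_one_of_far fun w hw => by linarith [h w hw]

theorem holeCutoff_eventuallyEq_one (hr : 0 < r)
    (hsep : SeparatedAt r Z)
    (hz : ∀ w ∈ Z, 3 * r < dist z w) : holeCutoff r Z =ᶠ[nhds z] fun _ => 1 := by
  by_cases h : ∃ w ∈ Z, dist z w < 50 * r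
  · obtain ⟨w, hw, hzw⟩ := h
    have ho : IsOpen {x | 3 * r < dist x w} := isOpen_lt continuous_const (by fun_prop)
    filter_upwards [isOpen_ball.mem_nhds (show z ∈ ball w (50 * r) from hzw),
      ho.mem_nhds (hz w hw)] with x hx hx'
    rw [holeCutoff_eq_radialStep hr hsep hw hx]
    apply radialStep_eq_one
    rw [norm_rescale hr, le_div_iff₀ hr]
    exact (le_of_lt hx')
  · push Not at h
    exact holeCutoff_eventuallyEq_one_of_far hr h

end holeCutoff

/-! ### Pointwise energy bounds off the holes. -/

/-- The union of the closed discs of radius `t r` with centres in `Z`. -/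
def holes (r t : ℝ) (Z : Set ℂ) : Set ℂ := ⋃ w ∈ Z, closedBall w (t * r)

/-- `f` is harmonic on `B(0, ρ)` off the discs of radius `r`, and does not change sign around each
of them. -/
def AdmissibleAt (r ρ : ℝ) (Z : Set ℂ) (f : ℂ → ℝ) : Prop :=
  HarmonicOnNhd f (ball 0 ρ \ holes r 1 Z) ∧
  ∀ z ∈ Z, NoSignChange f ((ball 0 ρ ∩ closedBall z (5 * r)) \ closedBall z (1 * r))

theorem mem_holes {r t : ℝ} {Z : Set ℂ} {z : ℂ} :
    z ∈ holes r t Z ↔ ∃ w ∈ Z, dist z w ≤ t * r := by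
  simp [holes]

/-- Separated centres carry disjoint open discs, so there are only countably many of them. -/
theorem SeparatedAt.measurableSet_holes {r : ℝ} {Z : Set ℂ} (hr : 0 < r) (h : SeparatedAt r Z)
    (t : ℝ) : MeasurableSet (holes r t Z) := by
  have hc : Z.Countable := by
    apply PairwiseDisjoint.countable_of_isOpen (s := fun w => ball w r) (a := Z)
    · intro z hz w hw hne
      apply ball_disjoint_ball
      linarith [h z hz w hw hne]
    · exact fun w _ => isOpen_ball
    · exact fun w _ => ⟨w, mem_ball_self hr⟩
  exact MeasurableSet.biUnion hc fun w _ => measurableSet_closedBall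

theorem SeparatedAt.notMem_holes {r t : ℝ} {Z : Set ℂ} {z w : ℂ} (hr : 0 < r)
    (h : SeparatedAt r Z) (hw : w ∈ Z) (hz1 : t * r < dist z w)
    (hz2 : dist z w ≤ 10 * r) : z ∉ holes r t Z := by
  rw [mem_holes]
  rintro ⟨w', hw', hz⟩
  by_cases hne : w' = w
  · subst hne; linarith
  · have := h w' hw' w hw hne
    have := dist_triangle_left w' w z
    linarith

/-- The square of `f` plus the square of its gradient at scale `r`. -/
def energy (r : ℝ) (f : ℂ → ℝ) (z : ℂ) : ℝ :=
  f z ^ 2 + r ^ 2 * (pderiv 1 f z ^ 2 + pderiv Complex.I f z ^ 2)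

theorem energy_le_of_abs_pderiv_le {r M G : ℝ} {f : ℂ → ℝ} {z : ℂ}
    (h0 : |f z| ≤ M) (h1 : ∀ v : ℂ, ‖v‖ = 1 → |fderiv ℝ f z v| ≤ G) :
    energy r f z ≤ M ^ 2 + r ^ 2 * (2 * G ^ 2) := by
  have e0 : f z ^ 2 ≤ M ^ 2 := by
    rw [← sq_abs]; exact pow_le_pow_left₀ (abs_nonneg _) h0 2
  have e1 : pderiv 1 f z ^ 2 ≤ G ^ 2 := by
    rw [← sq_abs]; exact pow_le_pow_left₀ (abs_nonneg _) (h1 1 (by simp)) 2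
  have e2 : pderiv Complex.I f z ^ 2 ≤ G ^ 2 := by
    rw [← sq_abs]; exact pow_le_pow_left₀ (abs_nonneg _) (h1 Complex.I (by simp)) 2
  unfold energy
  have := mul_le_mul_of_nonneg_left (add_le_add e1 e2) (sq_nonneg r)
  linarith

theorem energy_neg (r : ℝ) (f : ℂ → ℝ) (z : ℂ) : energy r (-f) z = energy r f z := by
  simp [energy, pderiv, fderiv_neg]

/-- This is the use of the sign condition. Without it, interior estimates would need the mass of `f`
all around `z`; here any single point `q` of the annulus controls `f` and its gradient at `z`. -/
theorem exists_energy_le_annulus : ∃ K : ℝ, 1 ≤ K ∧ ∀ (f : ℂ → ℝ) (w : ℂ) (r : ℝ), 0 < r →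
    HarmonicOnNhd f (ball w (5 * r) \ closedBall w r) →
    NoSignChange f (ball w (5 * r) \ closedBall w r) →
    ∀ z q : ℂ, 2 * r ≤ dist z w → dist z w ≤ 4 * r → 2 * r ≤ dist q w → dist q w ≤ 4 * r →
      energy r f z ≤ K * f q ^ 2 := by
  obtain ⟨K, hK, H⟩ := harnack_annulus
  have pos : ∀ (f : ℂ → ℝ) (w : ℂ) (r : ℝ), 0 < r →
      HarmonicOnNhd f (ball w (5 * r) \ closedBall w r) →
      (∀ x ∈ ball w (5 * r) \ closedBall w r, 0 ≤ f x) →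
      ∀ z q : ℂ, 2 * r ≤ dist z w → dist z w ≤ 4 * r → 2 * r ≤ dist q w → dist q w ≤ 4 * r →
        energy r f z ≤ 33 * K ^ 2 * f q ^ 2 := by
    intro f w r hr hf h0 z q hz1 hz2 hq1 hq2
    have hsub : ball z r ⊆ ball w (5 * r) \ closedBall w r := by
      intro x hx
      rw [mem_ball] at hx
      have := dist_triangle x z w
      have := dist_triangle_left z w x
      simp only [Set.mem_sdiff, mem_ball, mem_closedBall, not_le]
      constructor <;> linarith
    have hz0 : 0 ≤ f z := h0 z (hsub (mem_ball_self hr))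
    have hzq := H f w r hr hf h0 z q hz1 hz2 hq1 hq2
    have h1 := energy_le_of_abs_pderiv_le (r := r) (abs_of_nonneg hz0).le
      (abs_fderiv_le_of_nonneg hr (hf.mono hsub) fun x hx => h0 x (hsub hx))
    have h2 : f z ^ 2 ≤ (K * f q) ^ 2 := pow_le_pow_left₀ hz0 hzq 2
    -- `33 = 1 + 2 · 4²`, from the gradient bound at radius `r`.
    have h3 : f z ^ 2 + r ^ 2 * (2 * (4 / r * f z) ^ 2) = 33 * f z ^ 2 := by field_simp; ring
    rw [h3] at h1
    nlinarith
  refine ⟨33 * K ^ 2, by nlinarith, ?_⟩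
  intro f w r hr hf hs z q hz1 hz2 hq1 hq2
  rcases hs with hs | hs
  · exact pos f w r hr hf hs z q hz1 hz2 hq1 hq2
  · have := pos (-f) w r hr hf.neg (fun x hx => by simpa using hs x hx) z q hz1 hz2 hq1 hq2
    rw [energy_neg] at this
    simpa using this

theorem ofReal_le_of_le_ball {f : ℂ → ℝ} {p : ℂ} {ρ K E : ℝ} (hρ : 0 < ρ) (hK : 0 ≤ K)
    (h : ∀ q ∈ ball p ρ, E ≤ K * f q ^ 2) :
    ENNReal.ofReal E ≤ ENNReal.ofReal (K / (Real.pi * ρ ^ 2)) * sqInt f (ball p ρ) := by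
  have hv : volume (ball p ρ) = ENNReal.ofReal (Real.pi * ρ ^ 2) := by
    rw [← volume_real_ball p hρ.le, Measure.real, ENNReal.ofReal_toReal measure_ball_lt_top.ne]
  have hpos : 0 < Real.pi * ρ ^ 2 := by positivity
  have h1 : ENNReal.ofReal E * volume (ball p ρ) ≤ ENNReal.ofReal K * sqInt f (ball p ρ) := by
    rw [← setLIntegral_const, sqInt, ← lintegral_const_mul' _ _ ENNReal.ofReal_ne_top]
    apply setLIntegral_mono' measurableSet_ball
    intro q hq
    rw [← ENNReal.ofReal_mul hK]
    exact ENNReal.ofReal_le_ofReal (h q hq)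
  rw [hv] at h1
  rw [div_eq_mul_inv, ENNReal.ofReal_mul hK, ENNReal.ofReal_inv_of_pos hpos, mul_right_comm,
    ← div_eq_mul_inv, ENNReal.le_div_iff_mul_le]
  · exact h1
  · left; simpa using hpos
  · left; simp

theorem AdmissibleAt.harmonicOnNhd_annulus {r ρ : ℝ} {Z : Set ℂ} {f : ℂ → ℝ} {w : ℂ} (hr : 0 < r)
    (hsep : SeparatedAt r Z) (hf : AdmissibleAt r ρ Z f) (hw : w ∈ Z)
    (hwρ : ball w (5 * r) ⊆ ball 0 ρ) :
    HarmonicOnNhd f (ball w (5 * r) \ closedBall w r) ∧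
      NoSignChange f (ball w (5 * r) \ closedBall w r) := by
  constructor
  · apply hf.1.mono
    rintro x ⟨hx1, hx2⟩
    rw [mem_ball] at hx1
    rw [mem_closedBall, not_le] at hx2
    exact ⟨hwρ hx1, hsep.notMem_holes hr hw (by linarith) (by linarith)⟩
  · have hsub : ball w (5 * r) \ closedBall w r ⊆
        (ball 0 ρ ∩ closedBall w (5 * r)) \ closedBall w (1 * r) := by
      rw [one_mul]
      exact sdiff_subset_sdiff_left (subset_inter hwρ ball_subset_closedBall)
    exact (hf.2 w hw).imp (fun h x hx => h x (hsub hx)) (fun h x hx => h x (hsub hx))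

/-- Near a hole the energy is controlled by the mass of `f` on any small disc slightly further
out. -/
theorem exists_energy_le_sqInt_near : ∃ K : ℝ, 1 ≤ K ∧ ∀ (f : ℂ → ℝ) (Z : Set ℂ) (r ρ : ℝ), 0 < r →
    SeparatedAt r Z → AdmissibleAt r ρ Z f → ∀ w ∈ Z, ball w (5 * r) ⊆ ball 0 ρ →
    ∀ z p : ℂ, 2 * r ≤ dist z w → dist z w ≤ 4 * r → dist p w = 7 / 2 * r →
      ENNReal.ofReal (energy r f z) ≤ ENNReal.ofReal (K / r ^ 2) * sqInt f (ball p (r / 10)) := by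
  obtain ⟨K, hK, H⟩ := exists_energy_le_annulus
  refine ⟨100 * K, by linarith, ?_⟩
  intro f Z r ρ hr hsep hf w hw hwρ z p hz1 hz2 hp
  obtain ⟨h1, h2⟩ := hf.harmonicOnNhd_annulus hr hsep hw hwρ
  refine (ofReal_le_of_le_ball (f := f) (p := p) (ρ := r / 10) (K := K) (by linarith)
    (by linarith) ?_).trans ?_
  · intro q hq
    rw [mem_ball] at hq
    have := dist_triangle q p w
    have := dist_triangle_left p w q
    exact H f w r hr h1 h2 z q hz1 hz2 (by linarith) (by linarith)
  · gcongr ENNReal.ofReal ?_ * _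
    rw [div_le_div_iff₀ (by positivity) (by positivity)]
    have := Real.pi_gt_three
    have : 0 < K * r ^ 2 := by positivity
    nlinarith

/-- Off the holes of radius `2r`, the energy is controlled by the mass of `f` nearby and off the
holes of radius `3r`. -/
theorem exists_energy_le_sqInt : ∃ K : ℝ, 1 ≤ K ∧ ∀ (f : ℂ → ℝ) (Z : Set ℂ) (r ρ : ℝ), 0 < r →
    SeparatedAt r Z → AdmissibleAt r ρ Z f → ∀ z : ℂ, ball z (10 * r) ⊆ ball 0 ρ →
    (∀ w ∈ Z, 2 * r ≤ dist z w) →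
      ENNReal.ofReal (energy r f z)
        ≤ ENNReal.ofReal (K / r ^ 2) * sqInt f (ball z (10 * r) \ holes r 3 Z) := by
  obtain ⟨K, hK, H⟩ := exists_energy_le_sqInt_near
  -- Far from the holes, the mean value bound on discs of radius `r / 4` gives `M² = 32 T / r²`, and
  -- the gradient bound at radius `r / 8` gives the factor `8193 = 1 + 2 · 64²`.
  refine ⟨K + 32 * 8193, by linarith, ?_⟩
  intro f Z r ρ hr hsep hf z hzρ hz
  -- Within `7r/2` of a centre the Harnack bound on the annulus applies. Beyond that, the disc of
  -- radius `r / 2` about `z` misses all holes of radius `3r`, and interior estimates suffice.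
  by_cases hcase : ∃ w ∈ Z, dist z w ≤ 7 / 2 * r
  · obtain ⟨w, hw, hzw⟩ := hcase
    have hpw : dist (w + (7 / 2 * r : ℝ)) w = 7 / 2 * r := by
      rw [dist_eq_norm, add_sub_cancel_left, Complex.norm_real,
        Real.norm_of_nonneg (by linarith)]
    have hwρ : ball w (5 * r) ⊆ ball 0 ρ :=
      (ball_subset_ball' (by rw [dist_comm]; linarith)).trans hzρ
    refine (H f Z r ρ hr hsep hf w hw hwρ z (w + (7 / 2 * r : ℝ)) (hz w hw) (by linarith)
      hpw).trans ?_
    gcongr ENNReal.ofReal ?_ * ?_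
    · exact div_le_div_of_nonneg_right (by linarith) (by positivity)
    · apply lintegral_mono_set
      intro q hq
      rw [mem_ball] at hq
      have t1 := dist_triangle q (w + (7 / 2 * r : ℝ)) w
      have t2 := dist_triangle_left (w + ((7 / 2 * r : ℝ) : ℂ)) w q
      have t3 := dist_triangle_right q z w
      rw [hpw] at t1 t2
      refine ⟨?_, hsep.notMem_holes hr hw (by linarith) (by linarith)⟩
      rw [mem_ball]
      linarith
  · push Not at hcase
    have hsub : ball z (r / 2) ⊆ ball z (10 * r) \ holes r 3 Z := by
      intro x hx
      refine ⟨ball_subset_ball (by linarith) hx, ?_⟩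
      rw [mem_holes]
      rintro ⟨w, hw, hxw⟩
      rw [mem_ball] at hx
      have := hcase w hw
      have := dist_triangle_left z w x
      linarith
    have hharm : HarmonicOnNhd f (ball z (r / 2)) := by
      apply hf.1.mono
      intro x hx
      obtain ⟨h1, h2⟩ := hsub hx
      refine ⟨hzρ h1, fun h => h2 ?_⟩
      rw [mem_holes] at h ⊢
      obtain ⟨w, hw, h⟩ := h
      exact ⟨w, hw, by linarith⟩
    set I := sqInt f (ball z (10 * r) \ holes r 3 Z) with hI
    have hpos : 0 < (K + 32 * 8193) / r ^ 2 := by positivity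
    by_cases htop : I = ⊤
    · rw [htop, ENNReal.mul_top (by simpa using hpos)]
      exact le_top
    set T := I.toReal with hT
    have hIT : I = ENNReal.ofReal T := (ENNReal.ofReal_toReal htop).symm
    have hT0 : 0 ≤ T := ENNReal.toReal_nonneg
    have hsup : ∀ x ∈ ball z (r / 8), |f x| ≤ Real.sqrt (32 * T / r ^ 2) := by
      intro x hx
      rw [mem_ball] at hx
      have h1 := sq_le_sqInt_ball (f := f) (c := x) (ρ := r / 4) (by linarith)
        (hharm.mono (closedBall_subset_ball' (by linarith)))
      have h2 : sqInt f (ball x (r / 4)) ≤ I :=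
        lintegral_mono_set ((ball_subset_ball' (by linarith)).trans hsub)
      have h3 := h1.trans h2
      rw [hIT, ENNReal.ofReal_le_ofReal_iff hT0] at h3
      apply Real.abs_le_sqrt
      rw [le_div_iff₀ (by positivity)]
      have := Real.pi_gt_three
      have : 0 ≤ r ^ 2 * f x ^ 2 := by positivity
      nlinarith
    have he := energy_le_of_abs_pderiv_le (r := r) (hsup z (mem_ball_self (by linarith)))
      (abs_fderiv_le_of_abs_le (by linarith)
        (hharm.mono (ball_subset_ball (by linarith))) hsup)
    rw [hIT, ← ENNReal.ofReal_mul hpos.le]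
    apply ENNReal.ofReal_le_ofReal
    refine he.trans ?_
    rw [div_pow, mul_pow, Real.sq_sqrt (by positivity)]
    have h1 : 32 * T / r ^ 2 + r ^ 2 * (2 * (8 ^ 2 * (32 * T / r ^ 2) / (r / 8) ^ 2))
        = 32 * 8193 / r ^ 2 * T := by
      field_simp; ring
    rw [h1]
    gcongr
    linarith

/-! ### The Carleman estimate in the presence of holes. -/

/-- The integral of `f²` over `A` with weight `‖g‖²`. -/
def weightedSqInt (g : ℂ → ℂ) (f : ℂ → ℝ) (A : Set ℂ) : ℝ≥0∞ :=
  ∫⁻ z in A, ENNReal.ofReal (‖g z‖ ^ 2 * f z ^ 2)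

theorem continuous_weight_mul {g : ℂ → ℂ} {v : ℂ → ℝ} (hv : Continuous v)
    (hg : ∀ z ∈ tsupport v, ContinuousAt g z) : Continuous fun z => ‖g z‖ ^ 2 * v z ^ 2 := by
  rw [continuous_iff_continuousAt]
  intro z
  by_cases hz : z ∈ tsupport v
  · exact ((hg z hz).norm.pow 2).mul (hv.continuousAt.pow 2)
  · have h1 : (fun z => ‖g z‖ ^ 2 * v z ^ 2) =ᶠ[nhds z] fun _ => 0 := by
      filter_upwards [notMem_tsupport_iff_eventuallyEq.1 hz] with x hx
      simp [hx]
    exact continuousAt_const.congr h1.symm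

theorem integrable_weight_mul {g : ℂ → ℂ} {v : ℂ → ℝ} (hv : Continuous v)
    (hc : HasCompactSupport v) (hg : ∀ z ∈ tsupport v, ContinuousAt g z) :
    Integrable fun z => ‖g z‖ ^ 2 * v z ^ 2 := by
  apply (continuous_weight_mul hv hg).integrable_of_hasCompactSupport
  apply HasCompactSupport.mul_left
  exact hc.comp_left (g := fun x : ℝ => x ^ 2) (by simp)

theorem tsupport_lap_subset (u : ℂ → ℝ) : tsupport (lap u) ⊆ tsupport u := by
  refine (tsupport_add _ _).trans (union_subset ?_ ?_) <;>
  exact (tsupport_pderiv_subset _ _).trans (tsupport_pderiv_subset _ _)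

/-- The right side of the Carleman inequality is replaced by a supremum times an area. The
integrability of the left side is recorded because the absorption argument needs a finite quantity.
-/
theorem lintegral_carleman {u : ℂ → ℝ} {g : ℂ → ℂ} {R : ℝ} {B : ℝ≥0∞} (hR : 0 < R)
    (hu : ContDiff ℝ ∞ u) (huR : tsupport u ⊆ closedBall 0 R)
    (hg : ∀ z ∈ tsupport u, AnalyticAt ℂ g z)
    (hB : ∀ z, ENNReal.ofReal (‖g z‖ ^ 2 * lap u z ^ 2) ≤ B) :
    Integrable (fun z => ‖g z‖ ^ 2 * u z ^ 2) ∧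
    ∫⁻ z, ENNReal.ofReal (‖g z‖ ^ 2 * u z ^ 2)
      ≤ ENNReal.ofReal (16 * R ^ 4 * (Real.pi * (2 * R) ^ 2)) * B := by
  have huc : HasCompactSupport u := HasCompactSupport.of_support_subset_isCompact
    (isCompact_closedBall (0 : ℂ) R) ((subset_tsupport u).trans huR)
  have hlc : ContDiff ℝ ∞ (lap u) :=
    (contDiff_pderiv (contDiff_pderiv hu 1) 1).add
      (contDiff_pderiv (contDiff_pderiv hu Complex.I) Complex.I)
  have hls : HasCompactSupport (lap u) :=
    huc.mono' ((subset_tsupport _).trans (tsupport_lap_subset u))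
  have i1 := integrable_weight_mul hu.continuous huc fun z hz => (hg z hz).continuousAt
  have i2 := integrable_weight_mul hlc.continuous hls
    fun z hz => (hg z (tsupport_lap_subset u hz)).continuousAt
  refine ⟨i1, ?_⟩
  have n1 : ∀ z, 0 ≤ ‖g z‖ ^ 2 * u z ^ 2 := fun z => by positivity
  have n2 : ∀ z, 0 ≤ ‖g z‖ ^ 2 * lap u z ^ 2 := fun z => by positivity
  rw [← ofReal_integral_eq_lintegral_ofReal i1 (Filter.Eventually.of_forall n1)]
  refine (ENNReal.ofReal_le_ofReal (carleman hu huc huR hg)).trans ?_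
  have hR4 : 0 ≤ 16 * R ^ 4 := by positivity
  rw [ENNReal.ofReal_mul hR4, ENNReal.ofReal_mul hR4, mul_assoc,
    ofReal_integral_eq_lintegral_ofReal i2 (Filter.Eventually.of_forall n2)]
  refine mul_le_mul_right ?_ _
  have hsupp : ∀ z ∉ ball (0 : ℂ) (2 * R), ENNReal.ofReal (‖g z‖ ^ 2 * lap u z ^ 2) = 0 := by
    intro z hz
    have : lap u z = 0 := by
      by_contra hne
      have h1 := huR (tsupport_lap_subset u (subset_tsupport _ hne))
      rw [mem_closedBall] at h1
      rw [mem_ball] at hz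
      linarith
    simp [this]
  rw [← setLIntegral_eq_of_support_subset (s := ball (0 : ℂ) (2 * R))
    (fun z hz => by_contra fun h => hz (hsupp z h))]
  refine (setLIntegral_mono measurable_const fun z _ => hB z).trans ?_
  rw [setLIntegral_const, mul_comm, ← volume_real_ball (0 : ℂ) (by linarith : 0 ≤ 2 * R),
    Measure.real, ENNReal.ofReal_toReal measure_ball_lt_top.ne]

/-- The Carleman argument for a function with holes: the mass of `f` near each hole is absorbed
by the factor `δ` that the weight gains near that hole. -/
theorem exists_weightedSqInt_le {χ : ℂ → ℝ} {R : ℝ} (hR : 0 < R) (hχ : ContDiff ℝ ∞ χ)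
    (hχ1 : ∀ z, |χ z| ≤ 1) (hχR : tsupport χ ⊆ closedBall 0 R) :
    ∃ K : ℝ, 0 < K ∧ ∀ (r ρ δ : ℝ) (Z : Set ℂ) (f : ℂ → ℝ) (g : ℂ → ℂ) (A : Set ℂ) (Q : ℝ≥0∞),
      0 < r → r ≤ 1 → 0 ≤ δ → SeparatedAt r Z → AdmissibleAt r ρ Z f → IsOpen A →
      (∀ z ∈ A, χ z = 1) → (∀ z ∈ tsupport χ, AnalyticAt ℂ g z) →
      (∀ z ∈ tsupport χ, ball z (10 * r) ⊆ ball 0 ρ) →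
      (∀ z ∈ tsupport χ, ball z (10 * r) ⊆ A ∨
        ENNReal.ofReal (‖g z‖ ^ 2) * sqInt f (ball z (10 * r) \ holes r 3 Z) ≤ Q) →
      (∀ w ∈ Z, ball w (5 * r) ⊆ A → ∃ p, dist p w = 7 / 2 * r ∧
        ∀ z ∈ closedBall w (3 * r), ∀ q ∈ ball p (r / 10), ‖g z‖ ^ 2 ≤ δ * ‖g q‖ ^ 2) →
      K / r ^ 6 * δ ≤ 1 / 2 →
      weightedSqInt g f (A \ holes r 3 Z) ≤ ENNReal.ofReal (2 * (K / r ^ 6)) * Q := by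
  obtain ⟨K₁, hK₁, H₁⟩ := exists_energy_le_sqInt_near
  obtain ⟨K₂, hK₂, H₂⟩ := exists_energy_le_sqInt
  obtain ⟨Kψ, hKψ, Hψ⟩ := exists_cutoffBound_radialStep
  obtain ⟨Kχ, hKχ, Hχ⟩ := exists_cutoffBound hχ hχ1 0
    (by
      simp only [sub_zero]
      exact HasCompactSupport.of_support_subset_isCompact
        (isCompact_closedBall (0 : ℂ) R) ((subset_tsupport χ).trans hχR))
  set L := Kχ + Kψ + 4 * Kχ * Kψ with hL
  have hL0 : 0 ≤ L := by positivity
  set M := 12 * (L + 1) ^ 2 * (K₁ + K₂) with hM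
  have hM0 : 0 < M := by positivity
  refine ⟨16 * R ^ 4 * (Real.pi * (2 * R) ^ 2) * M, by positivity, ?_⟩
  intro r ρ δ Z f g A Q hr hr1 hδ hsep hf hA hχA hg hρ hQ hsteep hsmall
  set X := weightedSqInt g f (A \ holes r 3 Z) with hX
  set η : ℂ → ℝ := fun z => χ z * holeCutoff r Z z with hη
  set u : ℂ → ℝ := fun z => η z * f z with hu_def
  have hξ := contDiff_holeCutoff hr hsep
  have hηs : ContDiff ℝ ∞ η := hχ.mul hξ
  have hηb : ∀ z, CutoffBound L r η z := fun z =>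
    ((Hχ z).of_one hr hr1).mul (cutoffBound_holeCutoff hKψ Hψ hr hsep z) hχ.contDiffAt
      hξ.contDiffAt hr
  have hzero1 : ∀ z ∉ tsupport χ, u =ᶠ[nhds z] fun _ => 0 := by
    intro z hz
    filter_upwards [notMem_tsupport_iff_eventuallyEq.1 hz] with x hx
    simp [hu_def, hη, hx]
  have hzero2 : ∀ z, ∀ w ∈ Z, dist z w < 2 * r → u =ᶠ[nhds z] fun _ => 0 := by
    intro z w hw hz
    filter_upwards [holeCutoff_eventuallyEq_zero hr hsep hw hz] with x hx
    simp [hu_def, hη, hx]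
  have hharm : ∀ z ∈ tsupport χ, (∀ w ∈ Z, 2 * r ≤ dist z w) → HarmonicAt f z := by
    intro z hz hzw
    apply hf.1 z
    refine ⟨hρ z hz (mem_ball_self (by linarith)), ?_⟩
    rw [mem_holes]
    rintro ⟨w, hw, h⟩
    linarith [hzw w hw]
  have hus : ContDiff ℝ ∞ u := by
    rw [contDiff_iff_contDiffAt]
    intro z
    by_cases hz : z ∈ tsupport χ
    · by_cases hzw : ∀ w ∈ Z, 2 * r ≤ dist z w
      · exact hηs.contDiffAt.mul (contDiffAt_of_harmonicAt (hharm z hz hzw))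
      · push Not at hzw
        obtain ⟨w, hw, h⟩ := hzw
        exact contDiffAt_const.congr_of_eventuallyEq (hzero2 z w hw h)
    · exact contDiffAt_const.congr_of_eventuallyEq (hzero1 z hz)
  have hutχ : tsupport u ⊆ tsupport χ := by
    intro z hz
    by_contra h
    exact notMem_tsupport_iff_eventuallyEq.2 (hzero1 z h) hz
  have hlap0 : lap (fun _ => (0 : ℝ)) = fun _ => 0 := by
    have hp0 : ∀ v, pderiv v (fun _ => (0 : ℝ)) = fun _ => 0 := fun v => by
      ext x; simp [pderiv]
    ext z; simp [lap, hp0]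
  -- The exponent 6 is 4 from the squared second-order cutoff bound plus 2 from passing from
  -- pointwise energy to mass.
  have hpt : ∀ z, ENNReal.ofReal (‖g z‖ ^ 2 * lap u z ^ 2)
      ≤ ENNReal.ofReal (M / r ^ 6) * (ENNReal.ofReal δ * X + Q) := by
    intro z
    by_cases hz : z ∈ tsupport χ
    swap
    · rw [lap_congr (hzero1 z hz), hlap0]; simp
    by_cases hzw : ∀ w ∈ Z, 2 * r ≤ dist z w
    swap
    · push Not at hzw
      obtain ⟨w, hw, h⟩ := hzw
      rw [lap_congr (hzero2 z w hw h), hlap0]; simp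
    have hh := hharm z hz hzw
    have hlap := (hηb z).sq_lap_mul_le hηs.contDiffAt hh hr
    have hsuff : ∀ (K : ℝ) (Y : ℝ≥0∞), 0 ≤ K → K ≤ K₁ + K₂ →
        ENNReal.ofReal (energy r f z) ≤ ENNReal.ofReal (K / r ^ 2) * Y →
        ENNReal.ofReal (‖g z‖ ^ 2) * Y ≤ ENNReal.ofReal δ * X + Q →
        ENNReal.ofReal (‖g z‖ ^ 2 * lap u z ^ 2)
          ≤ ENNReal.ofReal (M / r ^ 6) * (ENNReal.ofReal δ * X + Q) := by
      intro K Y hK0 hK hE hY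
      have hc : 0 ≤ 12 * L ^ 2 / r ^ 4 := by positivity
      calc ENNReal.ofReal (‖g z‖ ^ 2 * lap u z ^ 2)
          ≤ ENNReal.ofReal (‖g z‖ ^ 2 * (12 * L ^ 2 / r ^ 4 * energy r f z)) :=
            ENNReal.ofReal_le_ofReal (mul_le_mul_of_nonneg_left hlap (by positivity))
        _ = ENNReal.ofReal (‖g z‖ ^ 2) * (ENNReal.ofReal (12 * L ^ 2 / r ^ 4)
              * ENNReal.ofReal (energy r f z)) := by
            rw [ENNReal.ofReal_mul (by positivity), ENNReal.ofReal_mul hc]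
        _ ≤ ENNReal.ofReal (‖g z‖ ^ 2) * (ENNReal.ofReal (12 * L ^ 2 / r ^ 4)
              * (ENNReal.ofReal (K / r ^ 2) * Y)) := by gcongr
        _ = ENNReal.ofReal (12 * L ^ 2 / r ^ 4) * ENNReal.ofReal (K / r ^ 2)
              * (ENNReal.ofReal (‖g z‖ ^ 2) * Y) := by ring
        _ ≤ ENNReal.ofReal (M / r ^ 6) * (ENNReal.ofReal δ * X + Q) := by
            gcongr
            rw [← ENNReal.ofReal_mul hc]
            apply ENNReal.ofReal_le_ofReal
            rw [div_mul_div_comm, ← pow_add, hM]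
            have : L ^ 2 ≤ (L + 1) ^ 2 := by nlinarith
            gcongr
    rcases hQ z hz with hbA | hbQ
    · have hzA : A ∈ nhds z := hA.mem_nhds (hbA (mem_ball_self (by linarith)))
      by_cases hfar : ∀ w ∈ Z, 3 * r < dist z w
      · have huf : u =ᶠ[nhds z] f := by
          filter_upwards [hzA, holeCutoff_eventuallyEq_one hr hsep hfar] with x hx hx'
          simp [hu_def, hη, hx', hχA x hx]
        rw [lap_congr huf, lap_eq_zero_of_harmonicAt hh]; simp
      · push Not at hfar
        obtain ⟨w, hw, hzw3⟩ := hfar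
        have hwz : ball w (5 * r) ⊆ ball z (10 * r) :=
          ball_subset_ball' (by rw [dist_comm]; linarith)
        -- A ring around a hole where `χ = 1`: the mass is moved to the disc about `p`, which lies
        -- in `A` off the holes and so is part of `X`, with the gain `δ`.
        obtain ⟨p, hp, hgp⟩ := hsteep w hw (hwz.trans hbA)
        refine hsuff K₁ (sqInt f (ball p (r / 10))) (by linarith) (by linarith)
          (H₁ f Z r ρ hr hsep hf w hw (hwz.trans (hρ z hz)) z p (hzw w hw) (by linarith) hp) ?_
        refine le_trans ?_ le_self_add
        have hsub : ball p (r / 10) ⊆ A \ holes r 3 Z := by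
          intro q hq
          rw [mem_ball] at hq
          have t1 := dist_triangle q p w
          have t2 := dist_triangle_left p w q
          refine ⟨hbA (hwz ?_), hsep.notMem_holes hr hw (by linarith) (by linarith)⟩
          rw [mem_ball]
          linarith
        calc ENNReal.ofReal (‖g z‖ ^ 2) * sqInt f (ball p (r / 10))
            ≤ ENNReal.ofReal δ * weightedSqInt g f (ball p (r / 10)) := by
              rw [sqInt, weightedSqInt, ← lintegral_const_mul' _ _ ENNReal.ofReal_ne_top,
                ← lintegral_const_mul' _ _ ENNReal.ofReal_ne_top]
              apply setLIntegral_mono' measurableSet_ball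
              intro q hq
              rw [← ENNReal.ofReal_mul (by positivity), ← ENNReal.ofReal_mul hδ, ← mul_assoc]
              exact ENNReal.ofReal_le_ofReal
                (mul_le_mul_of_nonneg_right (hgp z hzw3 q hq) (sq_nonneg _))
          _ ≤ ENNReal.ofReal δ * X := by
              gcongr
              exact lintegral_mono_set hsub
    · exact hsuff K₂ _ (by linarith) (by linarith)
        (H₂ f Z r ρ hr hsep hf z (hρ z hz) hzw) (hbQ.trans le_add_self)
  obtain ⟨hint, hcar⟩ := lintegral_carleman hR hus (hutχ.trans hχR) (fun z hz => hg z (hutχ hz)) hpt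
  have hmeas : Measurable fun z => ENNReal.ofReal (‖g z‖ ^ 2 * u z ^ 2) :=
    (continuous_weight_mul hus.continuous
      fun z hz => (hg z (hutχ hz)).continuousAt).measurable.ennreal_ofReal
  have hXle : X ≤ ∫⁻ z, ENNReal.ofReal (‖g z‖ ^ 2 * u z ^ 2) := by
    refine (setLIntegral_mono hmeas ?_).trans (setLIntegral_le_lintegral _ _)
    rintro z ⟨hzA, hzh⟩
    have h1 : holeCutoff r Z z = 1 := by
      apply holeCutoff_eq_one hr hsep
      intro w hw
      by_contra h
      exact hzh (mem_holes.2 ⟨w, hw, by linarith⟩)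
    simp [hu_def, hη, h1, hχA z hzA]
  -- Finiteness of `X` makes it legitimate to subtract `X / 2` from both sides at the end.
  have hXfin : X ≠ ⊤ := ne_top_of_le_ne_top hint.lintegral_lt_top.ne hXle
  have hmain := hXle.trans hcar
  set c := 16 * R ^ 4 * (Real.pi * (2 * R) ^ 2) with hc
  have hc0 : 0 ≤ c := by positivity
  rw [← mul_assoc, ← ENNReal.ofReal_mul hc0, ← mul_div_assoc] at hmain
  set P := c * M / r ^ 6 with hP
  have hP0 : 0 ≤ P := by positivity
  by_cases hQtop : Q = ⊤
  · rw [hQtop, ENNReal.mul_top]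
    · exact le_top
    · have : 0 < P := by positivity
      simpa using this
  rw [← ENNReal.ofReal_toReal hXfin, ← ENNReal.ofReal_toReal hQtop, ← ENNReal.ofReal_mul hδ,
    ← ENNReal.ofReal_add (by positivity) (by positivity), ← ENNReal.ofReal_mul hP0,
    ENNReal.ofReal_le_ofReal_iff (by positivity)] at hmain
  rw [← ENNReal.ofReal_toReal hXfin, ← ENNReal.ofReal_toReal hQtop,
    ← ENNReal.ofReal_mul (by positivity)]
  apply ENNReal.ofReal_le_ofReal
  have : P * δ * X.toReal ≤ 1 / 2 * X.toReal :=
    mul_le_mul_of_nonneg_right hsmall ENNReal.toReal_nonneg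
  linarith

/-! ### The two weights: `exp (κ z)` on a disc and `z⁻ᵏ` on an annulus. -/

/-- A smooth radial function equal to `1` on `‖z‖ ≤ a` and vanishing on `‖z‖ ≥ b`. -/
def radialCutoff (a b : ℝ) (z : ℂ) : ℝ :=
  Real.smoothTransition ((b ^ 2 - ‖z‖ ^ 2) / (b ^ 2 - a ^ 2))

section radialCutoff

variable {a b : ℝ} {z : ℂ}

theorem contDiff_radialCutoff : ContDiff ℝ ∞ (radialCutoff a b) :=
  Real.smoothTransition.contDiff.comp ((contDiff_const.sub (contDiff_norm_sq ℝ)).div_const _)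

theorem radialCutoff_eq_one (ha : 0 < a) (hab : a < b) (hz : ‖z‖ ≤ a) :
    radialCutoff a b z = 1 := by
  apply Real.smoothTransition.one_of_one_le
  rw [le_div_iff₀ (by nlinarith)]
  nlinarith [norm_nonneg z]

theorem radialCutoff_eq_zero (ha : 0 < a) (hab : a < b) (hz : b ≤ ‖z‖) :
    radialCutoff a b z = 0 := by
  apply Real.smoothTransition.zero_of_nonpos
  apply div_nonpos_of_nonpos_of_nonneg <;> nlinarith

theorem radialCutoff_mem_Icc : radialCutoff a b z ∈ Icc (0 : ℝ) 1 :=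
  ⟨Real.smoothTransition.nonneg _, Real.smoothTransition.le_one _⟩

theorem abs_radialCutoff_le_one : |radialCutoff a b z| ≤ 1 := abs_smoothTransition_le_one _

theorem tsupport_radialCutoff_subset (ha : 0 < a) (hab : a < b) :
    tsupport (radialCutoff a b) ⊆ closedBall 0 b := by
  apply closure_minimal _ isClosed_closedBall
  intro z hz
  by_contra h
  simp only [mem_closedBall, dist_zero_right, not_le] at h
  exact hz (radialCutoff_eq_zero ha hab h.le)

end radialCutoff

theorem norm_lt_of_mem_ball {x z : ℂ} {t : ℝ} (hx : x ∈ ball z t) :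
    ‖x‖ < ‖z‖ + t ∧ ‖z‖ - t < ‖x‖ := by
  rw [mem_ball, dist_eq_norm] at hx
  have h1 := norm_le_norm_add_norm_sub' x z
  have h2 := norm_le_norm_add_norm_sub' z x
  rw [norm_sub_rev] at h2
  constructor <;> linarith

theorem le_ofReal_mul_of_ofReal_inv_mul_le {a : ℝ} {x y : ℝ≥0∞} (ha : 0 < a)
    (h : ENNReal.ofReal a⁻¹ * x ≤ y) : x ≤ ENNReal.ofReal a * y := by
  calc x = ENNReal.ofReal a * (ENNReal.ofReal a⁻¹ * x) := by
        rw [← mul_assoc, ← ENNReal.ofReal_mul ha.le, mul_inv_cancel₀ ha.ne', ENNReal.ofReal_one,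
          one_mul]
    _ ≤ _ := by gcongr

theorem ofReal_mul_sqInt_le_weightedSqInt {g : ℂ → ℂ} {f : ℂ → ℝ} {A B : Set ℂ} {m : ℝ}
    (hm : 0 ≤ m) (hB : MeasurableSet B) (hBA : B ⊆ A) (h : ∀ z ∈ B, m ≤ ‖g z‖ ^ 2) :
    ENNReal.ofReal m * sqInt f B ≤ weightedSqInt g f A := by
  refine le_trans ?_ (lintegral_mono_set hBA)
  rw [sqInt, ← lintegral_const_mul' _ _ ENNReal.ofReal_ne_top]
  apply setLIntegral_mono' hB
  intro z hz
  rw [← ENNReal.ofReal_mul hm]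
  exact ENNReal.ofReal_le_ofReal (mul_le_mul_of_nonneg_right (h z hz) (sq_nonneg _))

/-- Propagation of smallness from an annulus inwards, with weight `‖exp (κ z)‖²`. -/
theorem exists_sqInt_ball_le {S₁ S₂ S₀ : ℝ} (h1 : 0 < S₁) (h12 : S₁ < S₂) (h20 : S₂ < S₀) :
    ∃ K : ℝ, 0 < K ∧ ∃ r₀ : ℝ, 0 < r₀ ∧ ∀ (r κ : ℝ) (Z : Set ℂ) (f : ℂ → ℝ), 0 < r → r ≤ r₀ →
      0 ≤ κ → SeparatedAt r Z → AdmissibleAt r S₀ Z f →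
      K / r ^ 6 * Real.exp (-(4 / 5 * κ * r)) ≤ 1 / 2 →
      sqInt f (ball 0 S₁ \ holes r 3 Z) ≤ ENNReal.ofReal (Real.exp (4 * κ * S₂)) *
        (ENNReal.ofReal (2 * (K / r ^ 6)) *
          sqInt f ((ball 0 S₂ \ ball 0 S₁) \ holes r 3 Z)) := by
  set d := S₂ - S₁ with hd
  have hd0 : 0 < d := by linarith
  have ha : 0 < S₁ + d / 3 := by linarith
  have hab : S₁ + d / 3 < S₁ + 2 * d / 3 := by linarith
  have hts := tsupport_radialCutoff_subset ha hab
  obtain ⟨K, hK, H⟩ := exists_weightedSqInt_le (χ := radialCutoff (S₁ + d / 3) (S₁ + 2 * d / 3))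
    (R := S₁ + 2 * d / 3) (by linarith) contDiff_radialCutoff (fun z => abs_radialCutoff_le_one) hts
  -- With `10r ≤ d / 10`, discs of radius `10r` about the transition layer of the cutoff stay inside
  -- the annulus between `S₁` and `S₂`.
  refine ⟨K, hK, min 1 (d / 100), by positivity, ?_⟩
  intro r κ Z f hr hrr hκ hsep hf hsmall
  have hr1 : r ≤ 1 := hrr.trans (min_le_left _ _)
  have hrd : r ≤ d / 100 := hrr.trans (min_le_right _ _)
  have hg : ∀ z : ℂ, ‖Complex.exp (κ * z)‖ ^ 2 = Real.exp (2 * κ * z.re) := by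
    intro z
    rw [Complex.norm_exp, ← Real.exp_nat_mul, Complex.re_ofReal_mul]
    push_cast; ring_nf
  have key := H r S₀ (Real.exp (-(4 / 5 * κ * r))) Z f (fun z => Complex.exp (κ * z))
    (ball 0 (S₁ + d / 3))
    (ENNReal.ofReal (Real.exp (2 * κ * S₂)) * sqInt f ((ball 0 S₂ \ ball 0 S₁) \ holes r 3 Z))
    hr hr1 (Real.exp_pos _).le hsep hf isOpen_ball
    (fun z hz => radialCutoff_eq_one ha hab (by simpa using (mem_ball_zero_iff.1 hz).le))
    (fun z _ => by fun_prop)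
    (fun z hz x hx => by
      have h3 := mem_closedBall_zero_iff.1 (hts hz)
      have h4 := norm_lt_of_mem_ball hx
      rw [mem_ball_zero_iff]; linarith)
    (fun z hz => by
      have h3 := mem_closedBall_zero_iff.1 (hts hz)
      by_cases hz' : ‖z‖ ≤ S₁ + d / 3 - 10 * r
      · left
        intro x hx
        have h4 := norm_lt_of_mem_ball hx
        rw [mem_ball_zero_iff]; linarith
      · right
        push Not at hz'
        gcongr
        · rw [hg, Real.exp_le_exp]
          have : z.re ≤ S₂ := (Complex.re_le_norm z).trans (by linarith)
          gcongr
        · apply lintegral_mono_set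
          apply sdiff_subset_sdiff_left
          intro x hx
          have h4 := norm_lt_of_mem_ball hx
          rw [Set.mem_sdiff, mem_ball_zero_iff, mem_ball_zero_iff]
          constructor <;> linarith)
    (fun w hw _ => by
      -- The weight grows to the right, so `p` is taken there. Real parts on the two discs differ by
      -- at least `(7/2 - 1/10 - 3) r = 2r/5`, whence the gain `exp (-(4/5) κ r)`.
      refine ⟨w + (7 / 2 * r : ℝ), ?_, ?_⟩
      · rw [dist_eq_norm, add_sub_cancel_left, Complex.norm_real,
          Real.norm_of_nonneg (by linarith)]
      · intro z hz q hq
        simp only [hg]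
        rw [← Real.exp_add, Real.exp_le_exp]
        rw [mem_closedBall, dist_eq_norm] at hz
        rw [mem_ball, dist_eq_norm] at hq
        have e1 := (Complex.abs_re_le_norm (z - w)).trans hz
        have e2 := (Complex.abs_re_le_norm (q - (w + (7 / 2 * r : ℝ)))).trans hq.le
        rw [Complex.sub_re, abs_le] at e1
        rw [Complex.sub_re, Complex.add_re, Complex.ofReal_re, abs_le] at e2
        nlinarith [mul_nonneg hκ (by linarith : 0 ≤ q.re - z.re - 2 / 5 * r)])
    hsmall
  have hlow := ofReal_mul_sqInt_le_weightedSqInt (f := f) (g := fun z => Complex.exp (κ * z))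
    (A := ball 0 (S₁ + d / 3) \ holes r 3 Z) (B := ball 0 S₁ \ holes r 3 Z)
    (m := (Real.exp (2 * κ * S₂))⁻¹) (by positivity)
    (measurableSet_ball.diff (hsep.measurableSet_holes hr 3))
    (sdiff_subset_sdiff_left (ball_subset_ball (by linarith)))
    (fun z hz => by
      have h3 := mem_ball_zero_iff.1 hz.1
      rw [hg, ← Real.exp_neg, Real.exp_le_exp]
      have := (abs_le.1 (Complex.abs_re_le_norm z)).1
      nlinarith)
  refine (le_ofReal_mul_of_ofReal_inv_mul_le (Real.exp_pos _) (hlow.trans key)).trans_eq ?_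
  rw [show 4 * κ * S₂ = 2 * κ * S₂ + 2 * κ * S₂ by ring, Real.exp_add,
    ENNReal.ofReal_mul (Real.exp_pos _).le]
  ring

/-- Propagation of smallness from a disc outwards, with weight `‖z‖^{-2k}`. -/
theorem exists_sqInt_annulus_le {S S₀ : ℝ} (hS : 0 < S) (hS2 : S < S₀ / 2) :
    ∃ K : ℝ, 0 < K ∧ ∃ r₀ : ℝ, 0 < r₀ ∧ ∀ (r : ℝ) (k : ℕ) (Z : Set ℂ) (f : ℂ → ℝ), 0 < r →
      r ≤ r₀ → SeparatedAt r Z → AdmissibleAt r S₀ Z f →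
      K / r ^ 6 * Real.exp (-(4 / 5 * (k / S₀) * r)) ≤ 1 / 2 →
      sqInt f ((ball 0 (S₀ / 2) \ ball 0 S) \ holes r 3 Z) ≤
        ENNReal.ofReal (2 * (K / r ^ 6)) *
          (ENNReal.ofReal (Real.exp (2 * k * Real.log (2 * S₀ / S))) *
              sqInt f (ball 0 S \ holes r 3 Z) +
            ENNReal.ofReal (Real.exp (-(2 * k * Real.log (5 / 4)))) *
              sqInt f ((ball 0 S₀ \ ball 0 (S₀ / 2)) \ holes r 3 Z)) := by
  have hS0 : 0 < S₀ := by linarith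
  have a1 : 0 < S / 4 := by linarith
  have b1 : S / 4 < S / 2 := by linarith
  have a2 : 0 < 6 / 8 * S₀ := by linarith
  have b2 : 6 / 8 * S₀ < 7 / 8 * S₀ := by linarith
  -- The inner cutoff removes the pole of `z⁻ᵏ`, and its transition lies inside the disc of radius
  -- `S`, where the mass is allowed on the right.
  set χ : ℂ → ℝ := fun z => (1 - radialCutoff (S / 4) (S / 2) z) *
    radialCutoff (6 / 8 * S₀) (7 / 8 * S₀) z with hχ
  have hts : ∀ z ∈ tsupport χ, S / 4 ≤ ‖z‖ ∧ ‖z‖ ≤ 7 / 8 * S₀ := by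
    have hcl : IsClosed {z : ℂ | S / 4 ≤ ‖z‖ ∧ ‖z‖ ≤ 7 / 8 * S₀} :=
      (isClosed_le continuous_const continuous_norm).inter
        (isClosed_le continuous_norm continuous_const)
    apply closure_minimal _ hcl
    intro z hz
    by_contra h
    apply hz
    rw [mem_ofPred_eq, not_and_or, not_le, not_le] at h
    rcases h with h | h
    · simp [hχ, radialCutoff_eq_one a1 b1 h.le]
    · simp [hχ, radialCutoff_eq_zero a2 b2 h.le]
  obtain ⟨K, hK, H⟩ := exists_weightedSqInt_le (χ := χ) (R := 7 / 8 * S₀) (by linarith)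
    ((contDiff_const.sub contDiff_radialCutoff).mul contDiff_radialCutoff)
    (fun z => by
      rw [hχ, abs_mul]
      refine mul_le_one₀ ?_ (abs_nonneg _) abs_radialCutoff_le_one
      have := radialCutoff_mem_Icc (a := S / 4) (b := S / 2) (z := z)
      rw [abs_le]; constructor <;> linarith [this.1, this.2])
    (fun z hz => mem_closedBall_zero_iff.2 (hts z hz).2)
  refine ⟨K, hK, min 1 (S / 100), by positivity, ?_⟩
  intro r k Z f hr hrr hsep hf hsmall
  have hr1 : r ≤ 1 := hrr.trans (min_le_left _ _)
  have hrS : r ≤ S / 100 := hrr.trans (min_le_right _ _)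
  have hg : ∀ z : ℂ, ‖(z ^ k)⁻¹‖ ^ 2 = ((‖z‖ ^ k) ^ 2)⁻¹ := by
    intro z
    rw [norm_inv, norm_pow, inv_pow]
  have hgle : ∀ {m : ℝ} {z : ℂ}, 0 < m → m ≤ ‖z‖ → ‖(z ^ k)⁻¹‖ ^ 2 ≤ ((m ^ k) ^ 2)⁻¹ := by
    intro m z hm hmz
    rw [hg]
    gcongr
  set Iin := sqInt f (ball 0 S \ holes r 3 Z) with hIin
  set Iout := sqInt f ((ball 0 S₀ \ ball 0 (S₀ / 2)) \ holes r 3 Z) with hIout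
  set A : Set ℂ := {z | S / 2 < ‖z‖ ∧ ‖z‖ < 6 / 8 * S₀} with hA
  have key := H r S₀ (Real.exp (-(4 / 5 * (k / S₀) * r))) Z f (fun z => (z ^ k)⁻¹) A
    -- These are upper bounds for the weight on the two transition layers; `5/8` rather than `6/8`
    -- leaves room for the margin `10r`. Compared with the weight at radius `S₀ / 2` they give the
    -- ratios `2S₀ / S` and `4/5`.
    (ENNReal.ofReal (((S / 4) ^ k) ^ 2)⁻¹ * Iin + ENNReal.ofReal (((5 / 8 * S₀) ^ k) ^ 2)⁻¹ * Iout)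
    hr hr1 (Real.exp_pos _).le hsep hf
    ((isOpen_lt continuous_const continuous_norm).inter
      (isOpen_lt continuous_norm continuous_const))
    (fun z hz => by
      simp [hχ, radialCutoff_eq_zero a1 b1 hz.1.le, radialCutoff_eq_one a2 b2 hz.2.le])
    (fun z hz => by
      have hz0 : z ≠ 0 := norm_pos_iff.1 (lt_of_lt_of_le a1 (hts z hz).1)
      exact (analyticAt_id.pow k).inv (pow_ne_zero k hz0))
    (fun z hz x hx => by
      have h3 := (hts z hz).2
      have h4 := norm_lt_of_mem_ball hx
      rw [mem_ball_zero_iff]; linarith)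
    (fun z hz => by
      have h3 := hts z hz
      by_cases hz1 : ‖z‖ < S / 2 + 10 * r
      · right
        refine le_trans ?_ le_self_add
        gcongr
        · exact hgle a1 h3.1
        · apply lintegral_mono_set
          apply sdiff_subset_sdiff_left
          intro x hx
          have h4 := norm_lt_of_mem_ball hx
          rw [mem_ball_zero_iff]; linarith
      · push Not at hz1
        by_cases hz2 : 6 / 8 * S₀ - 10 * r < ‖z‖
        · right
          refine le_trans ?_ le_add_self
          gcongr
          · exact hgle (by linarith) (by linarith)
          · apply lintegral_mono_set
            apply sdiff_subset_sdiff_left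
            intro x hx
            have h4 := norm_lt_of_mem_ball hx
            rw [Set.mem_sdiff, mem_ball_zero_iff, mem_ball_zero_iff]
            constructor <;> linarith
        · left
          push Not at hz2
          intro x hx
          have h4 := norm_lt_of_mem_ball hx
          constructor <;> linarith)
    (fun w hw hwA => by
      have hw5 := hwA (mem_ball_self (by linarith))
      have hwn : 0 < ‖w‖ := by linarith [hw5.1]
      -- The weight grows towards the origin, so `p` is `w` moved radially inwards.
      refine ⟨w - ((7 / 2 * r / ‖w‖ : ℝ) : ℂ) * w, ?_, ?_⟩
      · rw [dist_eq_norm, sub_sub_cancel_left, norm_neg, norm_mul, Complex.norm_real,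
          Real.norm_of_nonneg (by positivity)]
        field_simp
      · intro z hz q hq
        have hpn : ‖w - ((7 / 2 * r / ‖w‖ : ℝ) : ℂ) * w‖ = ‖w‖ - 7 / 2 * r := by
          rw [show w - ((7 / 2 * r / ‖w‖ : ℝ) : ℂ) * w = ((1 - 7 / 2 * r / ‖w‖ : ℝ) : ℂ) * w by
            push_cast; ring, norm_mul, Complex.norm_real, Real.norm_of_nonneg]
          · field_simp
          · rw [sub_nonneg, div_le_one hwn]; linarith [hw5.1]
        have h4 := norm_lt_of_mem_ball hq
        rw [hpn] at h4
        rw [mem_closedBall, dist_eq_norm] at hz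
        have h5 := norm_le_norm_add_norm_sub' w z
        have h6 := norm_le_norm_add_norm_sub' z w
        rw [norm_sub_rev] at h5
        have hzn : 0 < ‖z‖ := by linarith [hw5.1]
        have hqn : 0 < ‖q‖ := by linarith [hw5.1]
        have hzS : ‖z‖ ≤ S₀ := by linarith [hw5.2]
        -- The additive gap `2r/5` between the moduli becomes a multiplicative one because `‖z‖ ≤
        -- S₀`; raising it to the power `2k` gives `δ`.
        have hqz : ‖q‖ ≤ Real.exp (-(2 / 5 * r / S₀)) * ‖z‖ := by
          have e1 := Real.add_one_le_exp (-(2 / 5 * r / S₀))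
          have e2 : 2 / 5 * r / S₀ * ‖z‖ ≤ 2 / 5 * r := by
            rw [div_mul_eq_mul_div, div_le_iff₀ hS0]
            gcongr
          nlinarith
        rw [hg, hg, ← div_eq_mul_inv, le_div_iff₀ (by positivity), inv_mul_le_iff₀ (by positivity)]
        have e3 : (‖q‖ ^ k) ^ 2 ≤ ((Real.exp (-(2 / 5 * r / S₀)) * ‖z‖) ^ k) ^ 2 := by gcongr
        refine e3.trans_eq ?_
        rw [mul_pow, mul_pow, mul_comm, ← Real.exp_nat_mul, ← Real.exp_nat_mul]
        congr 2
        push_cast; ring)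
    hsmall
  have hlow := ofReal_mul_sqInt_le_weightedSqInt (f := f) (g := fun z => (z ^ k)⁻¹)
    (A := A \ holes r 3 Z) (B := (ball 0 (S₀ / 2) \ ball 0 S) \ holes r 3 Z)
    (m := (((S₀ / 2) ^ k) ^ 2)⁻¹) (by positivity)
    ((measurableSet_ball.diff measurableSet_ball).diff (hsep.measurableSet_holes hr 3))
    (sdiff_subset_sdiff_left fun z hz => by
      rw [Set.mem_sdiff, mem_ball_zero_iff, mem_ball_zero_iff] at hz
      constructor <;> linarith)
    (fun z hz => by
      have hz' := hz.1
      rw [Set.mem_sdiff, mem_ball_zero_iff, mem_ball_zero_iff] at hz'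
      have : 0 < ‖z‖ := by linarith
      rw [hg]
      gcongr
      exact hz'.1.le)
  refine (le_ofReal_mul_of_ofReal_inv_mul_le (by positivity) (hlow.trans key)).trans_eq ?_
  have hratio : ∀ {x : ℝ}, 0 < x → ENNReal.ofReal (((S₀ / 2) ^ k) ^ 2) *
      ENNReal.ofReal ((x ^ k) ^ 2)⁻¹ = ENNReal.ofReal (Real.exp (2 * k * Real.log (S₀ / 2 / x))) := by
    intro x hx
    rw [← ENNReal.ofReal_mul (by positivity), ← div_eq_mul_inv, ← div_pow, ← div_pow, ← pow_mul]
    congr 1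
    have hpos : 0 < S₀ / 2 / x := by positivity
    conv_lhs => rw [← Real.exp_log hpos, ← Real.exp_nat_mul]
    congr 1
    push_cast; ring
  have e1 := hratio a1
  have e2 := hratio (show 0 < 5 / 8 * S₀ by linarith)
  rw [show S₀ / 2 / (S / 4) = 2 * S₀ / S by field_simp; ring] at e1
  rw [show S₀ / 2 / (5 / 8 * S₀) = (5 / 4)⁻¹ by field_simp; norm_num, Real.log_inv, mul_neg] at e2
  rw [← e1, ← e2]
  ring

/-! ### Asymptotics of the scale and the choice of parameters. -/

theorem tendsto_scale {c R₀ : ℝ} (hc : 0 < c) (hR₀ : 0 < R₀) :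
    Tendsto (scale c R₀) (𝓝[>] 0) (𝓝[>] 0) := by
  have h1 : Tendsto (fun h : ℝ => R₀ / h) (𝓝[>] 0) atTop := by
    simp only [div_eq_mul_inv]
    exact tendsto_inv_nhdsGT_zero.const_mul_atTop hR₀
  have h2 : Tendsto (fun h : ℝ => Real.log (R₀ / h)) (𝓝[>] 0) atTop :=
    Real.tendsto_log_atTop.comp h1
  have h3 : Tendsto (eps c R₀) (𝓝[>] 0) (𝓝 0) := h2.const_div_atTop c
  have h4 : Tendsto (fun h : ℝ => h) (𝓝[>] 0) (𝓝 0) := tendsto_nhdsWithin_of_tendsto_nhds tendsto_id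
  rw [tendsto_nhdsWithin_iff]
  have h5 := h4.mul h3
  rw [mul_zero] at h5
  refine ⟨h5, ?_⟩
  filter_upwards [h2.eventually_gt_atTop 0, self_mem_nhdsWithin] with h hh hpos
  exact mul_pos hpos (div_pos hc hh)

theorem Separated.separatedAt {c R₀ C₁ h : ℝ} {Z : Set ℂ} (hC₁ : 100 < C₁)
    (hs : 0 < scale c R₀ h) (hZ : Separated c R₀ C₁ h Z) : SeparatedAt (32 * scale c R₀ h) Z := by
  intro z hz w hw hne
  have h0 : 0 ≤ 1 * (32 * scale c R₀ h) := by positivity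
  have := hZ z hz w hw hne z (mem_closedBall_self h0) w (mem_closedBall_self h0)
  nlinarith

/-- The polynomial losses at scale `s` are negligible against `exp (ε log(1/s) / s)`. -/
theorem eventually_scale_bounds {K ε B r₀ : ℝ} (hK : 0 < K) (hε : 0 < ε) (hr₀ : 0 < r₀) :
    ∀ᶠ s : ℝ in 𝓝[>] 0, 0 < s ∧ 32 * s ≤ r₀ ∧ 0 < Real.log s⁻¹ / s ∧ B ≤ Real.log s⁻¹ / s ∧
      K / (32 * s) ^ 6 * Real.exp (-(7 * Real.log s⁻¹)) ≤ 1 / 2 ∧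
      2 * (K / (32 * s) ^ 6) ≤ Real.exp (ε * (Real.log s⁻¹ / s)) := by
  have hlt : ∀ a : ℝ, 0 < a → ∀ᶠ s : ℝ in 𝓝[>] 0, s < a := fun a ha =>
    (eventually_lt_nhds ha).filter_mono nhdsWithin_le_nhds
  have hinv : Tendsto (fun s : ℝ => s⁻¹) (𝓝[>] 0) atTop := tendsto_inv_nhdsGT_zero
  have hlog : Tendsto (fun s : ℝ => Real.log s⁻¹) (𝓝[>] 0) atTop :=
    Real.tendsto_log_atTop.comp hinv
  have hrate : Tendsto (fun s : ℝ => Real.log s⁻¹ / s) (𝓝[>] 0) atTop := by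
    simp only [div_eq_mul_inv]
    exact hlog.atTop_mul_atTop₀ hinv
  filter_upwards [self_mem_nhdsWithin, hlt (r₀ / 32) (by positivity), hrate.eventually_gt_atTop 0,
    hrate.eventually_ge_atTop B, hlt (1 / (2 * K)) (by positivity), hlt (ε / 7) (by positivity),
    hlog.eventually_gt_atTop 0] with s hs h1 h2 h3 h4 h5 h6
  replace hs : 0 < s := hs
  -- The exponent 7 is one more than the loss `s⁻⁶`, so one power of `s` is left to beat the
  -- constant.
  have hexp : Real.exp (7 * Real.log s⁻¹) = (s ^ 7)⁻¹ := by
    rw [show (7 : ℝ) * Real.log s⁻¹ = ((7 : ℕ) : ℝ) * Real.log s⁻¹ by norm_num, Real.exp_nat_mul,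
      Real.exp_log (by positivity), inv_pow]
  have hKs : 2 * K * s ≤ 1 := by
    rw [lt_div_iff₀ (by positivity)] at h4; linarith
  refine ⟨hs, by linarith, h2, h3, ?_, ?_⟩
  · rw [Real.exp_neg, hexp, inv_inv, show K / (32 * s) ^ 6 * s ^ 7 = K * s / 32 ^ 6 by field_simp,
      div_le_iff₀ (by norm_num)]
    linarith
  · calc 2 * (K / (32 * s) ^ 6) = 2 * K * s / 32 ^ 6 * (s ^ 7)⁻¹ := by field_simp
      _ ≤ 1 * (s ^ 7)⁻¹ := by
          gcongr
          rw [div_le_one (by norm_num)]; linarith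
      _ = Real.exp (7 * Real.log s⁻¹) := by rw [hexp, one_mul]
      _ ≤ Real.exp (ε * (Real.log s⁻¹ / s)) := by
          rw [Real.exp_le_exp, ← mul_div_assoc, le_div_iff₀ hs]
          nlinarith

theorem exists_pos_of_eventually {P : ℝ → Prop} (h : ∀ᶠ x in 𝓝[>] (0 : ℝ), P x) :
    ∃ x₀ > 0, ∀ x, 0 < x → x < x₀ → P x := by
  obtain ⟨a, ha, hsub⟩ := mem_nhdsGT_iff_exists_Ioo_subset.1 h
  exact ⟨a, ha, fun x h1 h2 => hsub ⟨h1, h2⟩⟩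

theorem interior_case {c R₀ C₁ S₀ S : ℝ} {Z : ℝ → Set ℂ} (hc : 0 < c) (hR₀ : 0 < R₀)
    (hC₁ : 100 < C₁) (hZ : ∀ᶠ h in 𝓝[>] (0 : ℝ), Separated c R₀ C₁ h (Z h))
    (hS : 0 < S) (hS2 : S < S₀ / 2) :
    ∃ Ct C : ℝ, 0 < C ∧ C < Ct ∧ ∃ h₀ > 0, ∀ h : ℝ, 0 < h → h < h₀ →
      ∀ f : ℂ → ℝ, Admissible c R₀ h S₀ (Z h) f →
        ENNReal.ofReal (Real.exp (-C * rate c R₀ h)) *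
            sqInt f ((ball 0 (S₀ / 2) \ ball 0 S) \ discs c R₀ h 3 (Z h))
          ≤ sqInt f (ball 0 S \ discs c R₀ h 3 (Z h)) +
            ENNReal.ofReal (Real.exp (-Ct * rate c R₀ h)) *
              sqInt f ((ball 0 S₀ \ ball 0 (S₀ / 2)) \ discs c R₀ h 3 (Z h)) := by
  have hS0 : 0 < S₀ := by linarith
  obtain ⟨K, hK, r₀, hr₀, H⟩ := exists_sqInt_annulus_le hS hS2
  -- Chosen so that `(4/5) (A Λ / S₀) (32 s) = 7 log (1/s)`, that is `δ ≤ s⁷` for `k ≥ A Λ`.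
  set A := 35 / 128 * S₀ with hA
  have hA0 : 0 < A := by positivity
  set ℓ := Real.log (2 * S₀ / S) with hℓ
  have hℓ0 : 0 < ℓ := Real.log_pos (by rw [lt_div_iff₀ hS]; linarith)
  set ε := A * Real.log (5 / 4) with hε
  have hε0 : 0 < ε := mul_pos hA0 (Real.log_pos (by norm_num))
  -- Since `k ≤ 2AΛ`, the inner term costs at most `4AℓΛ`, and the polynomial prefactor costs `εΛ`.
  -- The outer term gains at least `2εΛ`, so after paying for the prefactor a surplus `ε` makes the
  -- outer constant strictly larger.
  refine ⟨4 * A * ℓ + ε + ε, 4 * A * ℓ + ε, by positivity, by linarith, ?_⟩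
  apply exists_pos_of_eventually
  filter_upwards [hZ, (tendsto_scale hc hR₀).eventually
    -- `B = A⁻¹` ensures `A Λ ≥ 1`, so that rounding up to the integer `k` at most doubles it.
    (eventually_scale_bounds (B := A⁻¹) hK hε0 hr₀)] with h hsep hb f hf
  obtain ⟨hs, hsr, hΛ0, hΛA, hb1, hb2⟩ := hb
  set s := scale c R₀ h with hsdef
  have hrate : rate c R₀ h = Real.log s⁻¹ / s := rfl
  rw [hrate]
  set Λ := Real.log s⁻¹ / s with hΛ
  have hAΛ : 1 ≤ A * Λ := by rwa [inv_le_iff_one_le_mul₀' hA0] at hΛA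
  set k := ⌈A * Λ⌉₊ with hk
  have hk1 : A * Λ ≤ k := Nat.le_ceil _
  have hk2 : (k : ℝ) ≤ 2 * (A * Λ) := by
    have := Nat.ceil_lt_add_one (by positivity : 0 ≤ A * Λ)
    linarith
  have hδ : K / (32 * s) ^ 6 * Real.exp (-(4 / 5 * (k / S₀) * (32 * s))) ≤ 1 / 2 := by
    refine le_trans ?_ hb1
    refine mul_le_mul_of_nonneg_left (Real.exp_le_exp.2 (neg_le_neg ?_)) (by positivity)
    have e1 : 7 * Real.log s⁻¹ = 4 / 5 * (A * Λ / S₀) * (32 * s) := by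
      rw [hΛ, hA]; field_simp; ring
    rw [e1]
    gcongr
  have key := H (32 * s) k (Z h) f (by positivity) hsr (hsep.separatedAt hC₁ hs) hf hδ
  set Iin := sqInt f (ball 0 S \ discs c R₀ h 3 (Z h)) with hIin
  set Iout := sqInt f ((ball 0 S₀ \ ball 0 (S₀ / 2)) \ discs c R₀ h 3 (Z h)) with hIout
  set Imid := sqInt f ((ball 0 (S₀ / 2) \ ball 0 S) \ discs c R₀ h 3 (Z h)) with hImid
  replace key : Imid ≤ ENNReal.ofReal (2 * (K / (32 * s) ^ 6)) *
      (ENNReal.ofReal (Real.exp (2 * k * ℓ)) * Iin +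
        ENNReal.ofReal (Real.exp (-(2 * k * Real.log (5 / 4)))) * Iout) := key
  have hlog54 : 0 < Real.log (5 / 4) := Real.log_pos (by norm_num)
  have hcomb : ∀ x y : ℝ, -(4 * A * ℓ + ε) * Λ + ε * Λ + x ≤ y →
      ENNReal.ofReal (Real.exp (-(4 * A * ℓ + ε) * Λ)) * ENNReal.ofReal (2 * (K / (32 * s) ^ 6)) *
        ENNReal.ofReal (Real.exp x) ≤ ENNReal.ofReal (Real.exp y) := by
    intro x y hxy
    rw [← ENNReal.ofReal_mul (Real.exp_pos _).le, ← ENNReal.ofReal_mul (by positivity)]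
    apply ENNReal.ofReal_le_ofReal
    calc _ ≤ Real.exp (-(4 * A * ℓ + ε) * Λ) * Real.exp (ε * Λ) * Real.exp x := by gcongr
      _ = Real.exp (-(4 * A * ℓ + ε) * Λ + ε * Λ + x) := by rw [Real.exp_add, Real.exp_add]
      _ ≤ _ := Real.exp_le_exp.2 hxy
  have c1 := hcomb (2 * k * ℓ) 0 (by nlinarith)
  have c2 := hcomb (-(2 * k * Real.log (5 / 4))) (-(4 * A * ℓ + ε + ε) * Λ) (by
    have : A * Λ * Real.log (5 / 4) ≤ k * Real.log (5 / 4) := by gcongr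
    have e : ε * Λ = A * Λ * Real.log (5 / 4) := by rw [hε]; ring
    nlinarith)
  rw [Real.exp_zero, ENNReal.ofReal_one] at c1
  calc _ ≤ ENNReal.ofReal (Real.exp (-(4 * A * ℓ + ε) * Λ)) *
        (ENNReal.ofReal (2 * (K / (32 * s) ^ 6)) *
          (ENNReal.ofReal (Real.exp (2 * k * ℓ)) * Iin +
            ENNReal.ofReal (Real.exp (-(2 * k * Real.log (5 / 4)))) * Iout)) := by gcongr
    _ = ENNReal.ofReal (Real.exp (-(4 * A * ℓ + ε) * Λ)) *
          ENNReal.ofReal (2 * (K / (32 * s) ^ 6)) * ENNReal.ofReal (Real.exp (2 * k * ℓ)) * Iin +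
        ENNReal.ofReal (Real.exp (-(4 * A * ℓ + ε) * Λ)) *
          ENNReal.ofReal (2 * (K / (32 * s) ^ 6)) *
          ENNReal.ofReal (Real.exp (-(2 * k * Real.log (5 / 4)))) * Iout := by ring
    _ ≤ 1 * Iin + ENNReal.ofReal (Real.exp (-(4 * A * ℓ + ε + ε) * Λ)) * Iout := by gcongr
    _ = _ := by rw [one_mul]

theorem boundary_case {c R₀ C₁ S₀ S₁ S₂ : ℝ} {Z : ℝ → Set ℂ} (hc : 0 < c) (hR₀ : 0 < R₀)
    (hC₁ : 100 < C₁) (hZ : ∀ᶠ h in 𝓝[>] (0 : ℝ), Separated c R₀ C₁ h (Z h))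
    (hS₁ : 0 < S₁) (hS₁₂ : S₁ < S₂) (hS₂ : S₂ < S₀) :
    ∃ C : ℝ, 0 < C ∧ ∃ h₀ > 0, ∀ h : ℝ, 0 < h → h < h₀ →
      ∀ f : ℂ → ℝ, Admissible c R₀ h S₀ (Z h) f →
        ENNReal.ofReal (Real.exp (-C * rate c R₀ h)) *
            sqInt f (ball 0 S₁ \ discs c R₀ h 3 (Z h))
          ≤ sqInt f ((ball 0 S₂ \ ball 0 S₁) \ discs c R₀ h 3 (Z h)) := by
  obtain ⟨K, hK, r₀, hr₀, H⟩ := exists_sqInt_ball_le hS₁ hS₁₂ hS₂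
  -- With `κ = 35Λ/128` the weight oscillates by `exp (4κS₂) = exp (35 S₂ Λ / 32)`; the extra 1 pays
  -- for the polynomial prefactor.
  refine ⟨35 / 32 * S₂ + 1, by linarith, ?_⟩
  apply exists_pos_of_eventually
  filter_upwards [hZ, (tendsto_scale hc hR₀).eventually
    (eventually_scale_bounds (B := 0) hK one_pos hr₀)] with h hsep hb f hf
  obtain ⟨hs, hsr, hΛ0, -, hb1, hb2⟩ := hb
  set s := scale c R₀ h with hsdef
  have hrate : rate c R₀ h = Real.log s⁻¹ / s := rfl
  rw [hrate]
  set Λ := Real.log s⁻¹ / s with hΛ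
  have hδ : K / (32 * s) ^ 6 * Real.exp (-(4 / 5 * (35 / 128 * Λ) * (32 * s))) ≤ 1 / 2 := by
    have e1 : 4 / 5 * (35 / 128 * Λ) * (32 * s) = 7 * Real.log s⁻¹ := by
      rw [hΛ]; field_simp; ring
    rwa [e1]
  have key := H (32 * s) (35 / 128 * Λ) (Z h) f (by positivity) hsr (by positivity)
    (hsep.separatedAt hC₁ hs) hf hδ
  calc _ ≤ ENNReal.ofReal (Real.exp (-(35 / 32 * S₂ + 1) * Λ)) *
        (ENNReal.ofReal (Real.exp (4 * (35 / 128 * Λ) * S₂)) *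
          (ENNReal.ofReal (2 * (K / (32 * s) ^ 6)) *
            sqInt f ((ball 0 S₂ \ ball 0 S₁) \ discs c R₀ h 3 (Z h)))) := mul_le_mul_right key _
    _ = ENNReal.ofReal (Real.exp (-(35 / 32 * S₂ + 1) * Λ) *
          Real.exp (4 * (35 / 128 * Λ) * S₂) * (2 * (K / (32 * s) ^ 6))) *
            sqInt f ((ball 0 S₂ \ ball 0 S₁) \ discs c R₀ h 3 (Z h)) := by
        have e1 := Real.exp_pos (-(35 / 32 * S₂ + 1) * Λ)
        have e2 := Real.exp_pos (4 * (35 / 128 * Λ) * S₂)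
        rw [ENNReal.ofReal_mul (mul_pos e1 e2).le, ENNReal.ofReal_mul e1.le]
        simp only [mul_assoc]
    _ ≤ 1 * sqInt f ((ball 0 S₂ \ ball 0 S₁) \ discs c R₀ h 3 (Z h)) := by
        gcongr
        rw [← ENNReal.ofReal_one]
        apply ENNReal.ofReal_le_ofReal
        calc _ ≤ Real.exp (-(35 / 32 * S₂ + 1) * Λ) * Real.exp (4 * (35 / 128 * Λ) * S₂) *
              Real.exp (1 * Λ) := by gcongr
          _ = 1 := by
              rw [← Real.exp_add, ← Real.exp_add, ← Real.exp_zero]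
              congr 1; ring
    _ = _ := one_mul _

end ToyProblem

end

theorem mainTheorem2 (c R₀ : ℝ) (hc : 0 < c) (hR₀ : 0 < R₀)
    (C₁ : ℝ) (hC₁ : 100 < C₁)
    (Z : ℝ → Set ℂ)
    (hZ : ∀ᶠ h in nhdsWithin (0 : ℝ) (Set.Ioi 0), ToyProblem.Separated c R₀ C₁ h (Z h))
    (S₀ : ℝ) (hS₀ : 0 < S₀) :
    (∀ S : ℝ, 0 < S → S < S₀ →
      ∃ Ct C : ℝ, 0 < C ∧ C < Ct ∧ ∃ h₀ > 0, ∀ h : ℝ, 0 < h → h < h₀ →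
        ∀ f : ℂ → ℝ, ToyProblem.Admissible c R₀ h S₀ (Z h) f →
          ENNReal.ofReal (Real.exp (-C * ToyProblem.rate c R₀ h)) *
              ToyProblem.sqInt f ((Metric.ball 0 (S₀ / 2) \ Metric.ball 0 S) \
                ToyProblem.discs c R₀ h 3 (Z h))
            ≤ ToyProblem.sqInt f (Metric.ball 0 S \ ToyProblem.discs c R₀ h 3 (Z h)) +
              ENNReal.ofReal (Real.exp (-Ct * ToyProblem.rate c R₀ h)) *
                ToyProblem.sqInt f ((Metric.ball 0 S₀ \ Metric.ball 0 (S₀ / 2)) \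
                  ToyProblem.discs c R₀ h 3 (Z h))) ∧
    (∀ S₁ S₂ : ℝ, 0 < S₁ → S₁ < S₂ → S₂ < S₀ →
      ∃ C : ℝ, 0 < C ∧ ∃ h₀ > 0, ∀ h : ℝ, 0 < h → h < h₀ →
        ∀ f : ℂ → ℝ, ToyProblem.Admissible c R₀ h S₀ (Z h) f →
          ENNReal.ofReal (Real.exp (-C * ToyProblem.rate c R₀ h)) *
              ToyProblem.sqInt f (Metric.ball 0 S₁ \ ToyProblem.discs c R₀ h 3 (Z h))
            ≤ ToyProblem.sqInt f ((Metric.ball 0 S₂ \ Metric.ball 0 S₁) \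
                ToyProblem.discs c R₀ h 3 (Z h))) := by
  refine ⟨fun S hS _ => ?_, fun S₁ S₂ h1 h12 h2 =>
    ToyProblem.boundary_case hc hR₀ hC₁ hZ h1 h12 h2⟩
  by_cases hS2 : S < S₀ / 2
  · exact ToyProblem.interior_case hc hR₀ hC₁ hZ hS hS2
  -- If `S ≥ S₀ / 2` the annulus on the left is empty, so any constants will do.
  · refine ⟨2, 1, one_pos, one_lt_two, 1, one_pos, fun h _ _ f _ => ?_⟩
    have hempty : (Metric.ball (0 : ℂ) (S₀ / 2) \ Metric.ball 0 S) = ∅ :=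
      Set.sdiff_eq_empty.2 (Metric.ball_subset_ball (not_lt.1 hS2))
    rw [hempty, Set.empty_sdiff]
    simp [ToyProblem.sqInt]
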